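/- Let $G_{\mathbb R}$ be a connected semisimple real Lie group with Lie algebra $\mathfrak g_0$, let $\theta$ be a Cartan involution of $\mathfrak g_0$ with Cartan decomposition $\mathfrak g_0=\mathfrak k_0\oplus\mathfrak p_0$, and let $K\subset G_{\mathbb R}$ be the connected subgroup generated by the one-parameter subgroups with velocity in $\mathfrak k_0$ (a maximal compact subgroup when $G_{\mathbb R}$ has finite center). Assume that $G_{\mathbb R}$ is of hermitian type: there is a complex structure $J$ on $\mathfrak p_0$ ($J^2=-1$) that is orthogonal for the Killing form and commutes with the adjoint action of $\mathfrak k_0$. Write $\mathfrak g=\mathfrak g_0\otimes\mathbb C$, $\mathfrak k=\mathfrak k_0\otimes\mathbb C$, $\mathfrak p=\mathfrak p_0\otimes\mathbb C=\mathfrak p_+\oplus\mathfrak p_-$, where $\mathfrak p_\pm$ is the $\pm i$-eigenspace of $J$. Let $X$ be an irreducible Harish-Chandra module, i.e. an irreducible $(\mathfrak g,K)$-module: $\mathfrak g$ and $K$ act on the complex vector space $X\neq 0$, every vector is $K$-finite, $K$ acts continuously with differential the action of $\mathfrak k_0$, one has $k\cdot(x\cdot v)=(\mathrm{Ad}(k)x)\cdot(k\cdot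 v)$, and $X$ has no proper nonzero subspace stable under $\mathfrak g$ and $K$. Choose a finite-dimensional $K$-stable subspace $X_0$ generating $X$ as a $\mathfrak g$-module, put $X_n=\mathcal U_n(\mathfrak g)X_0$ (and $X_{-1}=0$), and let $I_X\subset S(\mathfrak g)$ be the annihilator of $\mathrm{gr}(X)=\bigoplus_{n\ge 0} X_n/X_{n-1}$. The associated variety $AV(X)\subset\mathfrak g$ is the zero set of $I_X$ in $\mathfrak g^*$, transported to $\mathfrak g$ by the Killing form. If $AV(X)\subset\mathfrak p_+$, then $X$ is a highest weight module with respect to positive systems containing the roots of $\mathfrak p_+$. That is: there exist a Cartan subalgebra $\mathfrak h\subset\mathfrak k$ of $\mathfrak g$ and a positive system $\Delta^+\subset\Delta(\mathfrak h,\mathfrak g)$ containing $\Delta(\mathfrak p_+)$ (the roots whose root space lies in $\mathfrak p_+$), and for every such pair $(\mathfrak h,\Delta^+)$ the module $X$ is generated over $\mathfrak g$ by a nonzero $\mathfrak h$-weight vector annihilated by all root vectors of roots in $\Delta^+$. -/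

import Mathlib

open scoped TensorProduct Manifold ContDiff DirectSum

noncomputable section

namespace HermitianHC

/-! ### Cartan involutions and Hermitian structures -/

section RealLieAlgebra

variable {L : Type*} [LieRing L] [LieAlgebra ℝ L]

/-- A Cartan involution of a real Lie algebra: an involutive automorphism `θ` such that
`-B(x, θ y)` is positive definite, where `B` is the Killing form. -/
structure IsCartanInvolution (θ : L →ₗ⁅ℝ⁆ L) : Prop where
  involutive : ∀ x, θ (θ x) = x
  posDef : ∀ x, x ≠ 0 → 0 < -killingForm ℝ L x (θ x)

/-- The fixed subalgebra `𝔨₀` of `θ`. -/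
def kReal (θ : L →ₗ⁅ℝ⁆ L) : LieSubalgebra ℝ L where
  carrier := {x | θ x = x}
  add_mem' := by
    intro a b ha hb
    simp only [Set.mem_ofPred_eq] at *
    rw [map_add, ha, hb]
  zero_mem' := by simp
  smul_mem' := by
    intro c x hx
    simp only [Set.mem_ofPred_eq] at *
    rw [map_smul, hx]
  lie_mem' := by
    intro x y hx hy
    change θ _ = _
    have hx' : θ x = x := hx
    have hy' : θ y = y := hy
    rw [LieHom.map_lie, hx', hy']

/-- The `(-1)`-eigenspace `𝔭₀` of `θ`. -/
def pReal (θ : L →ₗ⁅ℝ⁆ L) : Submodule ℝ L where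
  carrier := {x | θ x = -x}
  add_mem' := by
    intro a b ha hb
    simp only [Set.mem_ofPred_eq] at *
    rw [map_add, ha, hb, neg_add]
  zero_mem' := by simp
  smul_mem' := by
    intro c x hx
    simp only [Set.mem_ofPred_eq] at *
    rw [map_smul, hx, smul_neg]

theorem lie_mem_pReal {θ : L →ₗ⁅ℝ⁆ L} {x y : L} (hx : x ∈ kReal θ) (hy : y ∈ pReal θ) :
    ⁅x, y⁆ ∈ pReal θ := by
  have hx' : θ x = x := hx
  have hy' : θ y = -y := hy
  change θ _ = _
  rw [LieHom.map_lie, hx', hy', lie_neg]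

/-- `J` is an invariant Hermitian complex structure on `𝔭₀`: it squares to `-1`, is orthogonal for
the Killing form, and commutes with the adjoint action of `𝔨₀`. If `𝔤₀` is the Lie algebra of `G`
and `K` is the connected subgroup with Lie algebra `𝔨₀`, such a `J` is the same as a
`G`-invariant Hermitian structure on the symmetric space `G / K`, whose tangent space at the base
point is `𝔭₀`. -/
structure IsHermitianStructure (θ : L →ₗ⁅ℝ⁆ L) (J : pReal θ →ₗ[ℝ] pReal θ) : Prop where
  sq : ∀ y, J (J y) = -y
  orthogonal : ∀ y y', killingForm ℝ L (J y) (J y') = killingForm ℝ L y y'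
  equivariant : ∀ (x : L) (hx : x ∈ kReal θ) (y : pReal θ),
    J ⟨⁅x, (y : L)⁆, lie_mem_pReal hx y.2⟩ = ⟨⁅x, (J y : L)⁆, lie_mem_pReal hx (J y).2⟩

/-- The complexification `𝔨 = ℂ ⊗ 𝔨₀` inside `𝔤 = ℂ ⊗ 𝔤₀`. -/
def kComplex (θ : L →ₗ⁅ℝ⁆ L) : Submodule ℂ (ℂ ⊗[ℝ] L) :=
  (kReal θ).toSubmodule.baseChange ℂ

/-- The holomorphic tangent space `𝔭₊ ⊆ ℂ ⊗ 𝔭₀ ⊆ 𝔤`: the `i`-eigenspace of `J` on `ℂ ⊗ 𝔭₀`. -/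
def pPlus {θ : L →ₗ⁅ℝ⁆ L} (J : pReal θ →ₗ[ℝ] pReal θ) : Submodule ℂ (ℂ ⊗[ℝ] L) :=
  (Module.End.eigenspace (J.baseChange ℂ) Complex.I).map ((pReal θ).subtype.baseChange ℂ)

end RealLieAlgebra

/-! ### Positive systems and highest weight modules -/

section ComplexLieAlgebra

variable {𝔤 : Type*} [LieRing 𝔤] [LieAlgebra ℂ 𝔤]

/-- `α` is a root of `𝔤` with respect to `𝔥`. -/
def IsRoot (𝔥 : LieSubalgebra ℂ 𝔤) [𝔥.IsCartanSubalgebra] (α : Module.Dual ℂ 𝔥) : Prop :=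
  α ≠ 0 ∧ LieAlgebra.rootSpace 𝔥 (α : 𝔥 → ℂ) ≠ ⊥

/-- A positive system of roots: a set of roots, containing exactly one of `α`, `-α` for each root
`α`, and closed under sums that are roots. -/
structure IsPositiveSystem (𝔥 : LieSubalgebra ℂ 𝔤) [𝔥.IsCartanSubalgebra]
    (P : Set (Module.Dual ℂ 𝔥)) : Prop where
  isRoot : ∀ α ∈ P, IsRoot 𝔥 α
  trichotomy : ∀ α, IsRoot 𝔥 α → (α ∈ P ↔ -α ∉ P)
  add_mem : ∀ α ∈ P, ∀ β ∈ P, IsRoot 𝔥 (α + β) → α + β ∈ P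

variable (X : Type*) [AddCommGroup X] [Module ℂ X] [LieRingModule 𝔤 X] [LieModule ℂ 𝔤 X]

/-- `X` is a highest weight module with respect to `𝔥` and the positive system `P`: it is generated
by a nonzero `𝔥`-weight vector that is annihilated by all root vectors for roots in `P`. -/
def IsHighestWeightModule (𝔥 : LieSubalgebra ℂ 𝔤) [𝔥.IsCartanSubalgebra]
    (P : Set (Module.Dual ℂ 𝔥)) : Prop :=
  ∃ (v : X) (lam : Module.Dual ℂ 𝔥), v ≠ 0 ∧
    (∀ H : 𝔥, ⁅(H : 𝔤), v⁆ = lam H • v) ∧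
    (∀ α ∈ P, ∀ e ∈ LieAlgebra.rootSpace 𝔥 (α : 𝔥 → ℂ), ⁅(e : 𝔤), v⁆ = 0) ∧
    LieSubmodule.lieSpan ℂ 𝔤 {v} = (⊤ : LieSubmodule ℂ 𝔤 X)

/-! ### The associated variety -/

variable (𝔤) in
/-- The standard filtration `𝒰ₙ(𝔤)` of the enveloping algebra: the span of the products of at most
`n` elements of `𝔤`. -/
def uFil (n : ℕ) : Submodule ℂ (UniversalEnvelopingAlgebra ℂ 𝔤) :=
  (1 ⊔ Submodule.span ℂ (Set.range fun x : 𝔤 => UniversalEnvelopingAlgebra.ι ℂ x)) ^ n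

variable {X}

/-- The filtration `Xₙ = 𝒰ₙ(𝔤) X₀` of `X`. -/
def xFil (X₀ : Submodule ℂ X) (n : ℕ) : Submodule ℂ X :=
  Submodule.map₂
    (UniversalEnvelopingAlgebra.lift ℂ (LieModule.toEnd ℂ 𝔤 X)).toLinearMap (uFil 𝔤 n) X₀

/-- The previous filtration step `Xₙ₋₁`, with `X₋₁ = 0`. -/
def xFilPred (𝔤 : Type*) [LieRing 𝔤] [LieAlgebra ℂ 𝔤] {X : Type*} [AddCommGroup X] [Module ℂ X]
    [LieRingModule 𝔤 X] [LieModule ℂ 𝔤 X] (X₀ : Submodule ℂ X) : ℕ → Submodule ℂ X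
  | 0 => ⊥
  | n + 1 => xFil (𝔤 := 𝔤) X₀ n

theorem lie_mem_xFil (X₀ : Submodule ℂ X) (n : ℕ) (x : 𝔤) {v : X}
    (hv : v ∈ xFil (𝔤 := 𝔤) X₀ n) : ⁅x, v⁆ ∈ xFil (𝔤 := 𝔤) X₀ (n + 1) := by
  suffices h : xFil (𝔤 := 𝔤) X₀ n ≤
      (xFil (𝔤 := 𝔤) X₀ (n + 1)).comap (LieModule.toEnd ℂ 𝔤 X x) from h hv
  refine Submodule.map₂_le.2 fun u hu w hw => ?_
  have : LieModule.toEnd ℂ 𝔤 X x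
      ((UniversalEnvelopingAlgebra.lift ℂ (LieModule.toEnd ℂ 𝔤 X)).toLinearMap u w) =
      (UniversalEnvelopingAlgebra.lift ℂ (LieModule.toEnd ℂ 𝔤 X)).toLinearMap
        (UniversalEnvelopingAlgebra.ι ℂ x * u) w := by
    rw [AlgHom.toLinearMap_apply, AlgHom.toLinearMap_apply, map_mul,
      UniversalEnvelopingAlgebra.lift_ι_apply]
    rfl
  rw [Submodule.mem_comap, this]
  refine Submodule.apply_mem_map₂ _ ?_ hw
  unfold uFil at hu ⊢
  rw [pow_succ']
  exact Submodule.mul_mem_mul (Submodule.mem_sup_right (Submodule.subset_span ⟨x, rfl⟩)) hu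

theorem lie_mem_xFilPred (X₀ : Submodule ℂ X) (n : ℕ) (x : 𝔤) {v : X}
    (hv : v ∈ xFilPred 𝔤 X₀ n) : ⁅x, v⁆ ∈ xFil (𝔤 := 𝔤) X₀ n := by
  cases n with
  | zero =>
    have : v = 0 := by simpa [xFilPred] using hv
    simp [this]
  | succ n => exact lie_mem_xFil X₀ n x hv

/-- `Xₙ₋₁` as a subspace of `Xₙ`. -/
def grKer (𝔤 : Type*) [LieRing 𝔤] [LieAlgebra ℂ 𝔤] {X : Type*} [AddCommGroup X] [Module ℂ X]
    [LieRingModule 𝔤 X] [LieModule ℂ 𝔤 X] (X₀ : Submodule ℂ X) (n : ℕ) :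
    Submodule ℂ (xFil (𝔤 := 𝔤) X₀ n) :=
  (xFilPred 𝔤 X₀ n).comap (xFil (𝔤 := 𝔤) X₀ n).subtype

/-- The graded piece `Xₙ / Xₙ₋₁`. -/
abbrev GrPiece (𝔤 : Type*) [LieRing 𝔤] [LieAlgebra ℂ 𝔤] {X : Type*} [AddCommGroup X] [Module ℂ X]
    [LieRingModule 𝔤 X] [LieModule ℂ 𝔤 X] (X₀ : Submodule ℂ X) (n : ℕ) : Type _ :=
  xFil (𝔤 := 𝔤) X₀ n ⧸ grKer 𝔤 X₀ n

/-- The associated graded space `gr X = ⨁ₙ Xₙ / Xₙ₋₁`. -/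
abbrev Gr (𝔤 : Type*) [LieRing 𝔤] [LieAlgebra ℂ 𝔤] {X : Type*} [AddCommGroup X] [Module ℂ X]
    [LieRingModule 𝔤 X] [LieModule ℂ 𝔤 X] (X₀ : Submodule ℂ X) : Type _ :=
  ⨁ n : ℕ, GrPiece 𝔤 X₀ n

/-- The action of `𝔤` as maps `Xₙ → Xₙ₊₁`. -/
def filAct (X₀ : Submodule ℂ X) (n : ℕ) (x : 𝔤) :
    xFil (𝔤 := 𝔤) X₀ n →ₗ[ℂ] xFil (𝔤 := 𝔤) X₀ (n + 1) :=
  (LieModule.toEnd ℂ 𝔤 X x).restrict fun _ hv => lie_mem_xFil X₀ n x hv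

/-- The induced action of `𝔤` as maps `Xₙ / Xₙ₋₁ → Xₙ₊₁ / Xₙ`. -/
def grPieceAct (X₀ : Submodule ℂ X) (n : ℕ) (x : 𝔤) :
    GrPiece 𝔤 X₀ n →ₗ[ℂ] GrPiece 𝔤 X₀ (n + 1) :=
  Submodule.mapQ _ _ (filAct X₀ n x) fun _ hv => lie_mem_xFilPred X₀ n x hv

theorem grPieceAct_mk (X₀ : Submodule ℂ X) (n : ℕ) (x : 𝔤) (v : xFil (𝔤 := 𝔤) X₀ n) :
    grPieceAct X₀ n x (Submodule.Quotient.mk v) = Submodule.Quotient.mk (filAct X₀ n x v) :=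
  rfl

/-- The action of `𝔤` on `gr X`, raising degrees by one. -/
def grAct (X₀ : Submodule ℂ X) : 𝔤 →ₗ[ℂ] Module.End ℂ (Gr 𝔤 X₀) where
  toFun x := DirectSum.toModule ℂ ℕ _ fun n =>
    (DirectSum.lof ℂ ℕ (fun n => GrPiece 𝔤 X₀ n) (n + 1)) ∘ₗ grPieceAct X₀ n x
  map_add' x y := by
    refine DirectSum.linearMap_ext ℂ fun n => LinearMap.ext fun q => ?_
    obtain ⟨v, rfl⟩ := Submodule.Quotient.mk_surjective _ q
    simp only [LinearMap.comp_apply, LinearMap.add_apply, DirectSum.toModule_lof, grPieceAct_mk]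
    rw [← map_add, ← Submodule.Quotient.mk_add]
    congr 2
    exact Subtype.ext (add_lie x y (v : X))
  map_smul' c x := by
    refine DirectSum.linearMap_ext ℂ fun n => LinearMap.ext fun q => ?_
    obtain ⟨v, rfl⟩ := Submodule.Quotient.mk_surjective _ q
    simp only [LinearMap.comp_apply, LinearMap.smul_apply, DirectSum.toModule_lof, grPieceAct_mk,
      RingHom.id_apply]
    rw [← map_smul, ← Submodule.Quotient.mk_smul]
    congr 2
    exact Subtype.ext (smul_lie c x (v : X))

theorem grAct_comm (X₀ : Submodule ℂ X) (x y : 𝔤) :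
    grAct X₀ x * grAct X₀ y = grAct X₀ y * grAct X₀ x := by
  refine DirectSum.linearMap_ext ℂ fun n => LinearMap.ext fun q => ?_
  obtain ⟨v, rfl⟩ := Submodule.Quotient.mk_surjective _ q
  simp only [LinearMap.comp_apply, Module.End.mul_apply, grAct, LinearMap.coe_mk, AddHom.coe_mk,
    DirectSum.toModule_lof, grPieceAct_mk]
  congr 1
  refine (Submodule.Quotient.eq _).2 ?_
  change ⁅x, ⁅y, (v : X)⁆⁆ - ⁅y, ⁅x, (v : X)⁆⁆ ∈ xFil (𝔤 := 𝔤) X₀ (n + 1)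
  rw [← lie_lie]
  exact lie_mem_xFil X₀ n _ v.2

/-- The action of `S(𝔤) = gr 𝒰(𝔤)` on `gr X`. -/
def symAct (X₀ : Submodule ℂ X) : SymmetricAlgebra ℂ 𝔤 →ₐ[ℂ] Module.End ℂ (Gr 𝔤 X₀) :=
  RingCon.liftₐ _ (TensorAlgebra.lift ℂ (grAct X₀)) <| by
    refine RingCon.ringConGen_le.2 fun a b h => ?_
    induction h with
    | mul_comm x y =>
      rw [RingCon.ker_apply]
      simpa using grAct_comm X₀ x y

variable (𝔤) in
/-- The annihilator `I_X` of `gr X` in `S(𝔤)`, the algebra of polynomial functions on `𝔤*`. -/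
def annIdeal (X₀ : Submodule ℂ X) : Ideal (SymmetricAlgebra ℂ 𝔤) :=
  RingHom.ker (symAct X₀)

/-- The value of `p ∈ S(𝔤)`, as a polynomial function on `𝔤*`, at `ξ ∈ 𝔤*`. -/
def evalDual (ξ : Module.Dual ℂ 𝔤) : SymmetricAlgebra ℂ 𝔤 →ₐ[ℂ] ℂ :=
  SymmetricAlgebra.lift ξ

variable (𝔤) in
/-- The associated variety of `X`, computed from the filtration generated by `X₀`: the zero set of
`I_X` in `𝔤*`, transported to `𝔤` by the Killing form. -/
def assocVariety (X₀ : Submodule ℂ X) : Set 𝔤 :=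
  {y | ∀ p ∈ annIdeal 𝔤 X₀, evalDual (killingForm ℂ 𝔤 y) p = 0}

end ComplexLieAlgebra

/-! ### `(𝔤, K)`-modules -/

section LieGroups

variable {E : Type*} [NormedAddCommGroup E] [NormedSpace ℝ E]
  {G : Type*} [TopologicalSpace G] [ChartedSpace E G] [Group G]

/-- `φ` is a one-parameter subgroup of `G` with initial velocity `x`. -/
structure IsOneParam (φ : ℝ → G) (x : GroupLieAlgebra 𝓘(ℝ, E) G) : Prop where
  map_zero : φ 0 = 1
  map_add : ∀ s t, φ (s + t) = φ s * φ t
  hasDeriv : HasMFDerivAt 𝓘(ℝ, ℝ) 𝓘(ℝ, E) φ 0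
    (ContinuousLinearMap.toSpanSingleton ℝ (x : E))

/-- The adjoint action of `g` on the Lie algebra: the derivative at `1` of `h ↦ g h g⁻¹`. -/
def Ad (g : G) : GroupLieAlgebra 𝓘(ℝ, E) G →ₗ[ℝ] GroupLieAlgebra 𝓘(ℝ, E) G :=
  (show E →L[ℝ] E from mfderiv 𝓘(ℝ, E) 𝓘(ℝ, E) (fun h : G => g * h * g⁻¹) 1).toLinearMap

instance instLieGroupMinSmoothness [LieGroup 𝓘(ℝ, E) ∞ G] :
    LieGroup 𝓘(ℝ, E) (minSmoothness ℝ 3) G :=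
  LieGroup.of_le (n := ∞) (by
    rw [minSmoothness_of_isRCLikeNormedField]
    exact ENat.LEInfty.out)

variable [CompleteSpace E] [LieGroup 𝓘(ℝ, E) ∞ G]

/-- The analytic subgroup `K` of `G` with Lie algebra `𝔨₀`: the subgroup generated by the
one-parameter subgroups with velocity in `𝔨₀`. When `G` is connected semisimple with finite
center, it is a maximal compact subgroup of `G`. -/
def maxK (θ : GroupLieAlgebra 𝓘(ℝ, E) G →ₗ⁅ℝ⁆ GroupLieAlgebra 𝓘(ℝ, E) G) : Subgroup G :=
  Subgroup.closure {g | ∃ (x : GroupLieAlgebra 𝓘(ℝ, E) G) (φ : ℝ → G) (t : ℝ),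
    x ∈ kReal θ ∧ IsOneParam φ x ∧ g = φ t}

/-- The complexified Lie algebra `𝔤 = ℂ ⊗ 𝔤₀` of `G`. -/
abbrev gComplex (E : Type*) [NormedAddCommGroup E] [NormedSpace ℝ E]
    (G : Type*) [TopologicalSpace G] [ChartedSpace E G] [Group G] : Type _ :=
  ℂ ⊗[ℝ] GroupLieAlgebra 𝓘(ℝ, E) G

/-- A subspace of a representation is stable under the group. -/
def IsStable {Γ X : Type*} [Monoid Γ] [AddCommGroup X] [Module ℂ X]
    (π : Representation ℂ Γ X) (W : Submodule ℂ X) : Prop :=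
  ∀ k, ∀ w ∈ W, π k w ∈ W

variable {θ : GroupLieAlgebra 𝓘(ℝ, E) G →ₗ⁅ℝ⁆ GroupLieAlgebra 𝓘(ℝ, E) G}
  {X : Type*} [AddCommGroup X] [Module ℂ X]
  [LieRingModule (gComplex E G) X] [LieModule ℂ (gComplex E G) X]

/-- `X` with its action of `𝔤` and the representation `π` of `K` is a `(𝔤, K)`-module: every vector
is `K`-finite, the action of `K` is continuous, the two actions are compatible, and the
differential of the action of `K` is the action of `𝔨₀`. Continuity and differentiation take place
in finite-dimensional subspaces, so they may be tested on linear functionals. -/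
structure IsGKModule (π : Representation ℂ (maxK θ) X) : Prop where
  locallyFinite : ∀ v : X, ∃ W : Submodule ℂ X, FiniteDimensional ℂ W ∧ IsStable π W ∧ v ∈ W
  continuous : ∀ (v : X) (f : Module.Dual ℂ X), Continuous fun k : maxK θ => f (π k v)
  compatible : ∀ (k : maxK θ) (x : gComplex E G) (v : X),
    π k ⁅x, v⁆ = ⁅(Ad (k : G)).baseChange ℂ x, π k v⁆
  differential : ∀ x ∈ kReal θ, ∀ φ : ℝ → maxK θ, IsOneParam (fun t => (φ t : G)) x →
    ∀ (v : X) (f : Module.Dual ℂ X),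
      HasDerivAt (fun t => f (π (φ t) v)) (f ⁅(1 : ℂ) ⊗ₜ[ℝ] x, v⁆) 0

/-- `X` is an irreducible Harish-Chandra module: an irreducible `(𝔤, K)`-module. -/
structure IsIrreducibleHC (π : Representation ℂ (maxK θ) X) : Prop where
  isGKModule : IsGKModule π
  nontrivial : Nontrivial X
  irreducible : ∀ N : LieSubmodule ℂ (gComplex E G) X,
    IsStable π (N : Submodule ℂ X) → N = ⊥ ∨ N = ⊤

end LieGroups

/-- `(𝔥, P)` is a Cartan subalgebra of `𝔤` contained in `𝔨`, with a positive system that contains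
all the roots of `𝔭₊`. -/
structure IsAdapted {L : Type*} [LieRing L] [LieAlgebra ℝ L] {θ : L →ₗ⁅ℝ⁆ L}
    (J : pReal θ →ₗ[ℝ] pReal θ) (𝔥 : LieSubalgebra ℂ (ℂ ⊗[ℝ] L)) [𝔥.IsCartanSubalgebra]
    (P : Set (Module.Dual ℂ 𝔥)) : Prop where
  le_kComplex : 𝔥.toSubmodule ≤ kComplex θ
  isPositiveSystem : IsPositiveSystem 𝔥 P
  pPlus_subset : ∀ α, IsRoot 𝔥 α →
    (LieAlgebra.rootSpace 𝔥 (α : 𝔥 → ℂ)).toSubmodule ≤ pPlus J → α ∈ P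

end HermitianHC

end

/-! The orthogonality and `𝔨₀`-equivariance of `J` make its extension by zero on `𝔨₀` a derivation
of `𝔤₀`. All derivations are inner because the Killing form is nondegenerate, so some central `z` in
`𝔨₀` acts on `𝔭₀` as `J` (`exists_isComplexStructureElement`). The element `h = -i z` then grades
`𝔤` as `𝔭₊ ⊕ 𝔨 ⊕ 𝔭₋` with eigenvalues `1, 0, -1`, and `𝔭₊` is isotropic for the Killing form.

Hence the linear functions on `𝔤*` given by `𝔭₊` vanish on an associated variety inside `𝔭₊`. By the
Nullstellensatz a power of the ideal they generate annihilates `gr X`, which says that `N`-fold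
products from `𝔭₊` map `X₀` into `X_{N-1}` (`exists_actPow_le_xFilPred`). Reordering products so
that `𝔭₊` acts first shows that `X` is generated over `𝔨 ⊕ 𝔭₋` by the products of fewer than `N`
elements of `𝔭₊` applied to `X₀` (`xFil_le_of_actPow_le`). Since `𝔨 ⊕ 𝔭₋` never raises
`h`-eigenvalues, their real parts are bounded above on `X`. Raising an `h`-eigenvector by `𝔭₊` must
stop, at a nonzero vector killed by `𝔭₊` (`exists_lie_eq_zero_of_assocVariety`).

Such vectors inside a finite-dimensional `K`-stable subspace form a finite-dimensional `𝔨`-stable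
space. Positive root vectors of an adapted pair lie in `𝔭₊` or in `𝔨`, so a maximal weight in that
space gives a highest weight vector. It generates `X`: a `𝔤`-submodule is automatically `K`-stable,
by uniqueness for linear differential equations along the one-parameter subgroups generating `K`.

Adapted pairs exist because a maximal abelian subalgebra of `𝔨₀` contains `z`, whose centralizer is
`𝔨₀`. Its complexification is therefore a Cartan subalgebra of `𝔤`, and its roots can be ordered
lexicographically with `z` first. -/

namespace HermitianHC

/-! ### The filtration of `X` and reordering of products -/

section Filtration

variable {𝔤 : Type*} [LieRing 𝔤] [LieAlgebra ℂ 𝔤]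
  {X : Type*} [AddCommGroup X] [Module ℂ X] [LieRingModule 𝔤 X] [LieModule ℂ 𝔤 X]

/-- The span of the elements `⁅a, v⁆` with `a ∈ A` and `v ∈ V`. -/
def actSpan (A : Submodule ℂ 𝔤) (V : Submodule ℂ X) : Submodule ℂ X :=
  Submodule.map₂ (LieModule.toEnd ℂ 𝔤 X : 𝔤 →ₗ[ℂ] Module.End ℂ X) A V

theorem lie_mem_actSpan {A : Submodule ℂ 𝔤} {V : Submodule ℂ X} {a : 𝔤} {v : X}
    (ha : a ∈ A) (hv : v ∈ V) : ⁅a, v⁆ ∈ actSpan A V :=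
  Submodule.apply_mem_map₂ (LieModule.toEnd ℂ 𝔤 X : 𝔤 →ₗ[ℂ] Module.End ℂ X) ha hv

theorem actSpan_le {A : Submodule ℂ 𝔤} {V W : Submodule ℂ X} :
    actSpan A V ≤ W ↔ ∀ a ∈ A, ∀ v ∈ V, ⁅a, v⁆ ∈ W :=
  Submodule.map₂_le

/-- The subspace spanned by `n`-fold products of elements of `A` acting on `V`. -/
def actPow (A : Submodule ℂ 𝔤) (V : Submodule ℂ X) : ℕ → Submodule ℂ X
  | 0 => V
  | n + 1 => actSpan A (actPow A V n)

theorem actPow_le_of_stable {A : Submodule ℂ 𝔤} {V F : Submodule ℂ X} (h : V ≤ F)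
    (hF : ∀ a ∈ A, ∀ v ∈ F, ⁅a, v⁆ ∈ F) (n : ℕ) : actPow A V n ≤ F := by
  induction n with
  | zero => exact h
  | succ n ih => exact actSpan_le.2 fun a ha v hv => hF a ha v (ih hv)

variable (X₀ : Submodule ℂ X)

theorem xFil_zero : xFil (𝔤 := 𝔤) X₀ 0 = X₀ := by
  apply le_antisymm
  · refine Submodule.map₂_le.2 fun u hu w hw => ?_
    rw [uFil, pow_zero] at hu
    obtain ⟨c, rfl⟩ := Submodule.mem_one.1 hu
    rw [AlgHom.toLinearMap_apply, AlgHom.commutes, Module.algebraMap_end_apply]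
    exact X₀.smul_mem c hw
  · intro w hw
    have h1 : (1 : UniversalEnvelopingAlgebra ℂ 𝔤) ∈ uFil 𝔤 0 := by
      rw [uFil, pow_zero]
      exact Submodule.one_le.1 le_rfl
    have := Submodule.apply_mem_map₂
      (UniversalEnvelopingAlgebra.lift ℂ (LieModule.toEnd ℂ 𝔤 X)).toLinearMap h1 hw
    rwa [AlgHom.toLinearMap_apply, map_one, Module.End.one_apply] at this

/-- Since `𝒰ₙ₊₁ = (ℂ + 𝔤) 𝒰ₙ`, this serves as the induction principle for the filtration. -/
theorem xFil_succ_le {n : ℕ} {T : Submodule ℂ X} (h : xFil (𝔤 := 𝔤) X₀ n ≤ T)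
    (h' : ∀ x : 𝔤, ∀ v ∈ xFil (𝔤 := 𝔤) X₀ n, ⁅x, v⁆ ∈ T) : xFil (𝔤 := 𝔤) X₀ (n + 1) ≤ T := by
  refine Submodule.map₂_le.2 fun u hu w hw => ?_
  rw [uFil, pow_succ'] at hu
  induction hu using Submodule.mul_induction_on' with
  | mem_mul_mem a ha b hb =>
    have hbw := Submodule.apply_mem_map₂
      (UniversalEnvelopingAlgebra.lift ℂ (LieModule.toEnd ℂ 𝔤 X)).toLinearMap hb hw
    rw [AlgHom.toLinearMap_apply, map_mul, Module.End.mul_apply]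
    rw [AlgHom.toLinearMap_apply] at hbw
    obtain ⟨a₁, ha₁, a₂, ha₂, rfl⟩ := Submodule.mem_sup.1 ha
    rw [map_add, LinearMap.add_apply]
    refine T.add_mem ?_ ?_
    · obtain ⟨c, rfl⟩ := Submodule.mem_one.1 ha₁
      rw [AlgHom.commutes, Module.algebraMap_end_apply]
      exact T.smul_mem c (h hbw)
    · refine (Submodule.span_le.2 ?_ : _ ≤ T.comap
        ((UniversalEnvelopingAlgebra.lift ℂ (LieModule.toEnd ℂ 𝔤 X)).toLinearMap.flip _)) ha₂
      rintro _ ⟨x, rfl⟩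
      have := h' x _ hbw
      rwa [← LieModule.toEnd_apply_apply ℂ,
        ← UniversalEnvelopingAlgebra.lift_ι_apply ℂ (LieModule.toEnd ℂ 𝔤 X) x] at this
  | add a _ b _ ha hb =>
    rw [map_add, LinearMap.add_apply]
    exact T.add_mem ha hb

theorem xFil_le_succ (n : ℕ) : xFil (𝔤 := 𝔤) X₀ n ≤ xFil (𝔤 := 𝔤) X₀ (n + 1) := by
  refine Submodule.map₂_le_map₂_left ?_
  rw [uFil, uFil, pow_succ]
  exact le_mul_of_one_le_right' le_sup_left

theorem iSup_xFil_eq_top (hgen : LieSubmodule.lieSpan ℂ 𝔤 (X₀ : Set X) = ⊤) :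
    ⨆ n, xFil (𝔤 := 𝔤) X₀ n = ⊤ := by
  have hdir : Directed (· ≤ ·) (xFil (𝔤 := 𝔤) X₀) :=
    (monotone_nat_of_le_succ (xFil_le_succ X₀)).directed_le
  let N : LieSubmodule ℂ 𝔤 X :=
    { (⨆ n, xFil (𝔤 := 𝔤) X₀ n : Submodule ℂ X) with
      lie_mem := by
        intro x m hm
        obtain ⟨n, hn⟩ := (Submodule.mem_iSup_of_directed _ hdir).1 hm
        exact (Submodule.mem_iSup_of_directed _ hdir).2 ⟨n + 1, lie_mem_xFil X₀ n x hn⟩ }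
  have hN : N = ⊤ := by
    rw [eq_top_iff, ← hgen, LieSubmodule.lieSpan_le]
    intro v hv
    exact (Submodule.mem_iSup_of_directed _ hdir).2 ⟨0, by rw [xFil_zero]; exact hv⟩
  have := congrArg LieSubmodule.toSubmodule hN
  simpa [N] using this

variable {X₀}

theorem actSpan_xFilPred_le (A : Submodule ℂ 𝔤) {V : Submodule ℂ X} {n : ℕ}
    (h : V ≤ xFilPred 𝔤 X₀ n) : actSpan A V ≤ xFilPred 𝔤 X₀ (n + 1) :=
  actSpan_le.2 fun a _ _ hv => lie_mem_xFilPred X₀ n a (h hv)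

theorem actPow_le_xFilPred (A : Submodule ℂ 𝔤) {V : Submodule ℂ X} {n : ℕ}
    (h : V ≤ xFilPred 𝔤 X₀ n) (m : ℕ) : actPow A V m ≤ xFilPred 𝔤 X₀ (m + n) := by
  induction m with
  | zero => simpa [actPow] using h
  | succ m ih =>
    rw [add_right_comm]
    exact actSpan_xFilPred_le A ih

theorem actPow_le_xFil (A : Submodule ℂ 𝔤) {V : Submodule ℂ X} {n : ℕ}
    (h : V ≤ xFil (𝔤 := 𝔤) X₀ n) (m : ℕ) : actPow A V m ≤ xFil (𝔤 := 𝔤) X₀ (m + n) := by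
  -- `xFilPred` at `m + (n + 1)` unfolds to `xFil` at `m + n`.
  have := actPow_le_xFilPred (X₀ := X₀) A (n := n + 1) h m
  exact this

theorem actPow_xFil_zero_le (A : Submodule ℂ 𝔤) (m : ℕ) :
    actPow A X₀ m ≤ xFil (𝔤 := 𝔤) X₀ m :=
  actPow_le_xFil A (xFil_zero X₀).ge m

/-- Modulo lower filtration steps, an element of `A` can be moved to the right past elements
of `B`. -/
theorem lie_mem_actPow_sup (A B : Submodule ℂ 𝔤) {x : 𝔤} (hx : x ∈ A) (a b : ℕ) {w : X}
    (hw : w ∈ actPow B (actPow A X₀ b) a) :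
    ⁅x, w⁆ ∈ actPow B (actPow A X₀ (b + 1)) a ⊔ xFil (𝔤 := 𝔤) X₀ (a + b) := by
  induction a generalizing w with
  | zero => exact Submodule.mem_sup_left (lie_mem_actSpan hx hw)
  | succ a ih =>
    rw [add_right_comm]
    suffices h : actPow B (actPow A X₀ b) (a + 1) ≤
        (actPow B (actPow A X₀ (b + 1)) (a + 1) ⊔ xFil (𝔤 := 𝔤) X₀ (a + b + 1)).comap
          (LieModule.toEnd ℂ 𝔤 X x) from h hw
    refine actSpan_le.2 fun y hy v hv => ?_
    have hv' : v ∈ xFil (𝔤 := 𝔤) X₀ (a + b) :=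
      actPow_le_xFil B (actPow_xFil_zero_le A b) a hv
    rw [Submodule.mem_comap, LieModule.toEnd_apply_apply, leibniz_lie]
    refine Submodule.add_mem _ (Submodule.mem_sup_right (lie_mem_xFil X₀ _ _ hv')) ?_
    obtain ⟨s, hs, t, ht, hst⟩ := Submodule.mem_sup.1 (ih hv)
    rw [← hst, lie_add]
    exact Submodule.add_mem_sup (lie_mem_actSpan hy hs) (lie_mem_xFil X₀ _ _ ht)

theorem xFil_le_sup_iSup_actPow {A B : Submodule ℂ 𝔤} (hAB : A ⊔ B = ⊤) (m : ℕ) :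
    xFil (𝔤 := 𝔤) X₀ m ≤ xFilPred 𝔤 X₀ m ⊔
      ⨆ (p : ℕ × ℕ) (_ : p.1 + p.2 = m), actPow B (actPow A X₀ p.2) p.1 := by
  have key : ∀ {m : ℕ} (p : ℕ × ℕ), p.1 + p.2 = m → actPow B (actPow A X₀ p.2) p.1 ≤
      ⨆ (p : ℕ × ℕ) (_ : p.1 + p.2 = m), actPow B (actPow A X₀ p.2) p.1 := fun p hp =>
    le_iSup₂_of_le p hp le_rfl
  induction m with
  | zero =>
    rw [xFil_zero]
    exact le_sup_of_le_right (key (m := 0) (0, 0) rfl)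
  | succ m ih =>
    refine xFil_succ_le X₀ le_sup_left fun x v hv => ?_
    suffices h : xFilPred 𝔤 X₀ m ⊔
        ⨆ (p : ℕ × ℕ) (_ : p.1 + p.2 = m), actPow B (actPow A X₀ p.2) p.1 ≤
        (xFilPred 𝔤 X₀ (m + 1) ⊔ ⨆ (p : ℕ × ℕ) (_ : p.1 + p.2 = m + 1),
          actPow B (actPow A X₀ p.2) p.1).comap (LieModule.toEnd ℂ 𝔤 X x) from h (ih hv)
    refine sup_le (fun w hw => Submodule.mem_sup_left (lie_mem_xFilPred X₀ m x hw)) ?_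
    refine iSup₂_le fun p hp w hw => ?_
    obtain ⟨y, hy, z, hz, rfl⟩ := Submodule.mem_sup.1 (hAB.ge (Submodule.mem_top (x := x)))
    rw [Submodule.mem_comap, LieModule.toEnd_apply_apply, add_lie]
    refine Submodule.add_mem _ ?_ (Submodule.mem_sup_right
      (key (p.1 + 1, p.2) (by simp only; omega) (lie_mem_actSpan hz hw)))
    obtain ⟨s, hs, t, ht, hst⟩ := Submodule.mem_sup.1 (lie_mem_actPow_sup A B hy _ _ hw)
    rw [← hst, add_comm s t]
    rw [hp] at ht
    exact Submodule.add_mem_sup ht (key (p.1, p.2 + 1) (by simp only; omega) hs)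

/-- If `N`-fold products from `A` lower the filtration degree on `X₀`, then a `B`-stable subspace
containing the shorter products from `A` acting on `X₀` contains all of `X`. -/
theorem xFil_le_of_actPow_le {A B : Submodule ℂ 𝔤} (hAB : A ⊔ B = ⊤) {N : ℕ}
    (hN : actPow A X₀ N ≤ xFilPred 𝔤 X₀ N) {F : Submodule ℂ X}
    (hF : ∀ b < N, actPow A X₀ b ≤ F) (hB : ∀ b ∈ B, ∀ v ∈ F, ⁅b, v⁆ ∈ F) (m : ℕ) :
    xFil (𝔤 := 𝔤) X₀ m ≤ F := by
  have hN' : ∀ b, N ≤ b → actPow A X₀ b ≤ xFilPred 𝔤 X₀ b := by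
    intro b hb
    induction b, hb using Nat.le_induction with
    | base => exact hN
    | succ b _ ih => exact actSpan_xFilPred_le A ih
  induction m with
  | zero =>
    refine (xFil_le_sup_iSup_actPow hAB 0).trans (sup_le bot_le (iSup₂_le fun p hp => ?_))
    obtain ⟨a, b⟩ := p
    rcases lt_or_ge b N with hb | hb
    · exact actPow_le_of_stable (hF b hb) hB a
    -- A term with at least `N` factors from `A` drops into the previous step, which is zero here
    -- because `X₋₁ = 0`.
    · refine (actPow_le_xFilPred B (hN' b hb) a).trans ?_
      rw [show a + b = _ from hp]
      exact bot_le
  | succ m ih =>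
    refine (xFil_le_sup_iSup_actPow hAB _).trans (sup_le ih (iSup₂_le fun p hp => ?_))
    obtain ⟨a, b⟩ := p
    rcases lt_or_ge b N with hb | hb
    · exact actPow_le_of_stable (hF b hb) hB a
    · refine (actPow_le_xFilPred B (hN' b hb) a).trans ?_
      rw [show a + b = _ from hp]
      exact ih

end Filtration

/-! ### The Nullstellensatz on `gr X` -/

section Nullstellensatz

variable {𝔤 : Type*} [LieRing 𝔤] [LieAlgebra ℂ 𝔤]
  {X : Type*} [AddCommGroup X] [Module ℂ X] [LieRingModule 𝔤 X] [LieModule ℂ 𝔤 X]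
  {X₀ : Submodule ℂ X}

/-- Hilbert's Nullstellensatz for `S(V)`. -/
theorem mem_radical_of_lift_eq_zero {V : Type*} [AddCommGroup V] [Module ℂ V]
    [FiniteDimensional ℂ V] (I : Ideal (SymmetricAlgebra ℂ V)) (f : SymmetricAlgebra ℂ V)
    (h : ∀ ξ : Module.Dual ℂ V, (∀ p ∈ I, SymmetricAlgebra.lift ξ p = 0) →
      SymmetricAlgebra.lift ξ f = 0) : f ∈ I.radical := by
  let b := Module.finBasis ℂ V
  let e := SymmetricAlgebra.equivMvPolynomial b
  have he : ∀ (x : Fin (Module.finrank ℂ V) → ℂ) (p : SymmetricAlgebra ℂ V),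
      MvPolynomial.aeval x (e p) = SymmetricAlgebra.lift (b.constr ℂ x) p := by
    intro x p
    refine DFunLike.congr_fun (f := (MvPolynomial.aeval x).comp e.toAlgHom) ?_ p
    refine SymmetricAlgebra.algHom_ext (b.ext fun i => ?_)
    simp [e]
  have hmem : e f ∈ (I.comap e.symm.toRingEquiv.toRingHom).radical := by
    rw [← MvPolynomial.vanishingIdeal_zeroLocus_eq_radical (k := ℂ) (K := ℂ)]
    rw [MvPolynomial.mem_vanishingIdeal_iff]
    intro x hx
    rw [he]
    refine h _ fun p hp => ?_
    rw [← he]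
    refine hx (e p) ?_
    rw [Ideal.mem_comap]
    simpa using hp
  obtain ⟨n, hn⟩ := hmem
  refine ⟨n, ?_⟩
  rw [Ideal.mem_comap] at hn
  simpa using hn

theorem symAct_ι (x : 𝔤) : symAct X₀ (SymmetricAlgebra.ι ℂ 𝔤 x) = grAct X₀ x := by
  change TensorAlgebra.lift ℂ (grAct X₀) (TensorAlgebra.ι ℂ x) = grAct X₀ x
  exact TensorAlgebra.lift_ι_apply _ _

/-- The class of `v ∈ Xₙ` in `gr X`. -/
noncomputable def grClass (X₀ : Submodule ℂ X) (n : ℕ) : xFil (𝔤 := 𝔤) X₀ n →ₗ[ℂ] Gr 𝔤 X₀ :=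
  DirectSum.lof ℂ ℕ (fun n => GrPiece 𝔤 X₀ n) n ∘ₗ (grKer 𝔤 X₀ n).mkQ

theorem grAct_grClass (x : 𝔤) (n : ℕ) (v : xFil (𝔤 := 𝔤) X₀ n) :
    grAct X₀ x (grClass X₀ n v) = grClass X₀ (n + 1) (filAct X₀ n x v) := by
  simp [grAct, grClass, DirectSum.toModule_lof, grPieceAct_mk]

theorem grClass_eq_zero_iff {n : ℕ} (v : xFil (𝔤 := 𝔤) X₀ n) :
    grClass X₀ n v = 0 ↔ (v : X) ∈ xFilPred 𝔤 X₀ n := by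
  rw [grClass, LinearMap.comp_apply, Submodule.mkQ_apply, DirectSum.lof_eq_of,
    map_eq_zero_iff _ (DirectSum.of_injective n), Submodule.Quotient.mk_eq_zero]
  rfl

/-- Products of `n` elements of `A` on `X₀` give, in `gr X`, elements of `Jⁿ gr X`, where `J` is the
ideal generated by `A`. -/
theorem grClass_mem_of_mem_actPow (A : Submodule ℂ 𝔤) (n : ℕ) (v : xFil (𝔤 := 𝔤) X₀ n)
    (hv : (v : X) ∈ actPow A X₀ n) :
    grClass X₀ n v ∈ Submodule.map₂ (symAct X₀).toLinearMap
      (((Ideal.span (SymmetricAlgebra.ι ℂ 𝔤 '' A)) ^ n).restrictScalars ℂ) ⊤ := by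
  induction n with
  | zero =>
    have := Submodule.apply_mem_map₂ (symAct X₀).toLinearMap
      (p := ((Ideal.span (SymmetricAlgebra.ι ℂ 𝔤 '' A)) ^ 0).restrictScalars ℂ) (q := ⊤)
      (m := 1) (n := grClass X₀ 0 v) (by simp) Submodule.mem_top
    rwa [AlgHom.toLinearMap_apply, map_one, Module.End.one_apply] at this
  | succ n ih =>
    suffices h : actPow A X₀ (n + 1) ≤
        ((Submodule.map₂ (symAct X₀).toLinearMap
          (((Ideal.span (SymmetricAlgebra.ι ℂ 𝔤 '' A)) ^ (n + 1)).restrictScalars ℂ) ⊤).comap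
            (grClass X₀ (n + 1))).map (xFil (𝔤 := 𝔤) X₀ (n + 1)).subtype by
      obtain ⟨v', hv', hvv'⟩ := h hv
      rwa [← Subtype.ext (hvv' : (v' : X) = v)]
    refine actSpan_le.2 fun a ha w hw => ?_
    have hw' := actPow_xFil_zero_le A n hw
    refine ⟨filAct X₀ n a ⟨w, hw'⟩, ?_, rfl⟩
    rw [SetLike.mem_coe, Submodule.mem_comap, ← grAct_grClass]
    suffices h : Submodule.map₂ (symAct X₀).toLinearMap
        (((Ideal.span (SymmetricAlgebra.ι ℂ 𝔤 '' A)) ^ n).restrictScalars ℂ) ⊤ ≤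
        (Submodule.map₂ (symAct X₀).toLinearMap
          (((Ideal.span (SymmetricAlgebra.ι ℂ 𝔤 '' A)) ^ (n + 1)).restrictScalars ℂ) ⊤).comap
            (grAct X₀ a) from h (ih ⟨w, hw'⟩ hw)
    refine Submodule.map₂_le.2 fun s hs u _ => ?_
    have := Submodule.apply_mem_map₂ (symAct X₀).toLinearMap
      (p := ((Ideal.span (SymmetricAlgebra.ι ℂ 𝔤 '' A)) ^ (n + 1)).restrictScalars ℂ) (q := ⊤)
      (m := SymmetricAlgebra.ι ℂ 𝔤 a * s) (n := u)
      (by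
        rw [pow_succ']
        exact Ideal.mul_mem_mul (Ideal.subset_span ⟨a, ha, rfl⟩) hs) Submodule.mem_top
    rwa [AlgHom.toLinearMap_apply, map_mul, symAct_ι] at this

/-- The ideal generated by `A` vanishes on the zero set of `I_X`, so it lies in the radical. Being
finitely generated, it has a power inside `I_X`, and that power kills `gr X`. -/
theorem exists_actPow_le_xFilPred [FiniteDimensional ℂ 𝔤] [LieAlgebra.IsKilling ℂ 𝔤]
    (A : Submodule ℂ 𝔤) (hA : ∀ y ∈ assocVariety 𝔤 X₀, ∀ a ∈ A, killingForm ℂ 𝔤 y a = 0) :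
    ∃ n, actPow A X₀ n ≤ xFilPred 𝔤 X₀ n := by
  have hrad : Ideal.span (SymmetricAlgebra.ι ℂ 𝔤 '' A) ≤ (annIdeal 𝔤 X₀).radical := by
    rw [Ideal.span_le]
    rintro _ ⟨a, ha, rfl⟩
    refine mem_radical_of_lift_eq_zero _ _ fun ξ hξ => ?_
    -- Nondegeneracy turns every zero `ξ` of `I_X` in `𝔤*` into a point `y` of the associated
    -- variety in `𝔤`.
    obtain ⟨y, rfl⟩ := (LinearMap.BilinForm.toDual (killingForm ℂ 𝔤)
      (LieAlgebra.IsKilling.killingForm_nondegenerate ℂ 𝔤)).surjective ξ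
    rw [SymmetricAlgebra.lift_ι_apply]
    exact hA y hξ a ha
  have hfg : (Ideal.span (SymmetricAlgebra.ι ℂ 𝔤 '' A)).FG := by
    classical
    obtain ⟨t, ht⟩ := (IsNoetherian.noetherian A : A.FG)
    refine ⟨t.image (SymmetricAlgebra.ι ℂ 𝔤), le_antisymm ?_ ?_⟩
    · rw [Finset.coe_image]
      refine Ideal.span_mono (Set.image_mono ?_)
      rw [← ht]
      exact Submodule.subset_span
    · rw [Ideal.span_le]
      rintro _ ⟨a, ha, rfl⟩
      rw [SetLike.mem_coe, ← ht] at ha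
      refine (Submodule.span_le.2 fun x hx => ?_ : _ ≤ ((Ideal.span _).restrictScalars ℂ).comap
        (SymmetricAlgebra.ι ℂ 𝔤)) ha
      exact Ideal.subset_span (Finset.mem_coe.2 (Finset.mem_image_of_mem _ hx))
  obtain ⟨n, hn⟩ := Ideal.exists_pow_le_of_le_radical_of_fg hrad hfg
  refine ⟨n, fun v hv => ?_⟩
  have hmem := grClass_mem_of_mem_actPow A n ⟨v, actPow_xFil_zero_le A n hv⟩ hv
  refine (grClass_eq_zero_iff ⟨v, actPow_xFil_zero_le A n hv⟩).1 ?_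
  rw [← Submodule.mem_bot ℂ]
  refine Submodule.map₂_le.2 (fun s hs u _ => ?_) hmem
  have : symAct X₀ s = 0 := hn hs
  simp [this]

end Nullstellensatz

/-! ### Eigenvalues of the grading element are bounded above -/

section Grading

variable {𝔤 : Type*} [LieRing 𝔤] [LieAlgebra ℂ 𝔤]
  {X : Type*} [AddCommGroup X] [Module ℂ X] [LieRingModule 𝔤 X] [LieModule ℂ 𝔤 X]

theorem lie_mem_maxGenEigenspace {h x : 𝔤} {d : ℂ} (hx : ⁅h, x⁆ = d • x) {c : ℂ} {v : X}
    (hv : v ∈ (LieModule.toEnd ℂ 𝔤 X h).maxGenEigenspace c) :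
    ⁅x, v⁆ ∈ (LieModule.toEnd ℂ 𝔤 X h).maxGenEigenspace (c + d) := by
  rw [Module.End.mem_maxGenEigenspace] at hv ⊢
  obtain ⟨k, hk⟩ := hv
  refine ⟨k, ?_⟩
  -- The relation `[h, x] = d x` reads `(h - c - d) x = x (h - c)` as operators, and this is
  -- iterated `k` times.
  have key : ∀ w : X, ((LieModule.toEnd ℂ 𝔤 X h - (c + d) • 1) ^ k) ⁅x, w⁆ =
      ⁅x, ((LieModule.toEnd ℂ 𝔤 X h - c • 1) ^ k) w⁆ := by
    intro w
    clear hk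
    induction k generalizing w with
    | zero => simp
    | succ k ih =>
      have h1 : (LieModule.toEnd ℂ 𝔤 X h - (c + d) • 1) ⁅x, w⁆ =
          ⁅x, (LieModule.toEnd ℂ 𝔤 X h - c • 1) w⁆ := by
        simp only [LinearMap.sub_apply, LieModule.toEnd_apply_apply, LinearMap.smul_apply,
          Module.End.one_apply, lie_sub, lie_smul]
        rw [leibniz_lie, hx, smul_lie, add_smul]
        abel
      rw [pow_succ, pow_succ, Module.End.mul_apply, Module.End.mul_apply, h1, ih]
  rw [key, hk, lie_zero]

/-- The sum of the generalized eigenspaces of `h` for eigenvalues with real part at most `M`. -/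
def eigenLE (X : Type*) [AddCommGroup X] [Module ℂ X] [LieRingModule 𝔤 X] [LieModule ℂ 𝔤 X]
    (h : 𝔤) (M : ℝ) : Submodule ℂ X :=
  ⨆ (c : ℂ) (_ : c.re ≤ M), (LieModule.toEnd ℂ 𝔤 X h).maxGenEigenspace c

theorem eigenLE_mono (h : 𝔤) : Monotone (eigenLE X h) := fun _ _ hM =>
  biSup_mono fun _ hc => hc.trans hM

theorem lie_mem_eigenLE {h x : 𝔤} {d : ℂ} (hx : ⁅h, x⁆ = d • x) {M : ℝ} {v : X}
    (hv : v ∈ eigenLE X h M) : ⁅x, v⁆ ∈ eigenLE X h (M + d.re) := by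
  suffices H : eigenLE X h M ≤ (eigenLE X h (M + d.re)).comap (LieModule.toEnd ℂ 𝔤 X x) from H hv
  refine iSup₂_le fun c hc w hw => ?_
  refine (le_iSup₂_of_le (c + d) ?_ le_rfl :
    (LieModule.toEnd ℂ 𝔤 X h).maxGenEigenspace (c + d) ≤ _) (lie_mem_maxGenEigenspace hx hw)
  simpa using hc

/-- Over `ℂ` the space `V` is spanned by generalized eigenvectors of `h`. Finitely many generators
have a common bound because the spaces `eigenLE` increase with the bound. -/
theorem le_eigenLE_of_finiteDimensional (h : 𝔤) (V : Submodule ℂ X) [FiniteDimensional ℂ V]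
    (hV : ∀ v ∈ V, ⁅h, v⁆ ∈ V) : ∃ M, V ≤ eigenLE X h M := by
  have hle : V ≤ ⨆ M, eigenLE X h M := by
    have h1 : V ≤ ⨆ c, (LieModule.toEnd ℂ 𝔤 X h).maxGenEigenspace c := by
      let T : Module.End ℂ V := (LieModule.toEnd ℂ 𝔤 X h).restrict hV
      have hT : ∀ (c : ℂ) (k : ℕ) (w : V), (((T - c • 1) ^ k) w : X) =
          ((LieModule.toEnd ℂ 𝔤 X h - c • 1) ^ k) (w : X) := by
        intro c k
        induction k with
        | zero => simp
        | succ k ih =>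
          intro w
          rw [pow_succ, pow_succ, Module.End.mul_apply, Module.End.mul_apply, ih]
          rfl
      intro v hv
      have hv' : (⟨v, hv⟩ : V) ∈ ⨆ c, T.maxGenEigenspace c := by
        rw [Module.End.iSup_maxGenEigenspace_eq_top T]
        exact Submodule.mem_top
      suffices H : ⨆ c, T.maxGenEigenspace c ≤
          (⨆ c, (LieModule.toEnd ℂ 𝔤 X h).maxGenEigenspace c).comap V.subtype from H hv'
      refine iSup_le fun c w hw => ?_
      refine Submodule.mem_iSup_of_mem c ?_
      rw [Module.End.mem_maxGenEigenspace] at hw ⊢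
      obtain ⟨k, hk⟩ := hw
      exact ⟨k, by rw [Submodule.subtype_apply, ← hT, hk, ZeroMemClass.coe_zero]⟩
    refine h1.trans (iSup_le fun c => le_iSup_of_le c.re (le_iSup₂_of_le c le_rfl le_rfl))
  have hfg : V.FG := Module.Finite.iff_fg.1 inferInstance
  obtain ⟨s, rfl⟩ := hfg
  have hdir : Directed (· ≤ ·) (eigenLE X h) := (eigenLE_mono h).directed_le
  choose! M hM using fun v (hv : v ∈ s) =>
    (Submodule.mem_iSup_of_directed _ hdir).1 (hle (Submodule.subset_span hv))
  obtain ⟨B, hB⟩ := (s.image M).bddAbove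
  refine ⟨B, Submodule.span_le.2 fun v hv => eigenLE_mono h (hB ?_) (hM v hv)⟩
  exact Finset.mem_coe.2 (Finset.mem_image_of_mem M hv)

/-- If all generalized eigenvalues of `h` have real part at most `M`, then some eigenvector of `h`
is killed by the elements that raise the eigenvalue by one. -/
theorem exists_lie_eq_zero_of_eigenLE_eq_top {h : 𝔤} {M : ℝ} (hM : eigenLE X h M = ⊤)
    {A : Submodule ℂ 𝔤} (hA : ∀ a ∈ A, ⁅h, a⁆ = a) {c : ℂ} {v : X} (hv : v ≠ 0)
    (hc : ⁅h, v⁆ = c • v) : ∃ w : X, w ≠ 0 ∧ ∀ a ∈ A, ⁅a, w⁆ = 0 := by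
  by_contra! hcon
  have hall : ∀ n : ℕ, ∃ w : X, w ≠ 0 ∧ ⁅h, w⁆ = (c + n) • w := by
    intro n
    induction n with
    | zero => exact ⟨v, hv, by simpa using hc⟩
    | succ n ih =>
      obtain ⟨w, hw, hhw⟩ := ih
      obtain ⟨a, ha, haw⟩ := hcon w hw
      refine ⟨_, haw, ?_⟩
      rw [leibniz_lie, hA a ha, hhw, lie_smul, Nat.cast_succ, ← add_assoc, add_smul _ (1 : ℂ),
        one_smul, add_comm]
  -- After this many raisings the eigenvalue `c + n` has real part above `M`; independence of
  -- generalized eigenspaces then forces its eigenvector to vanish.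
  obtain ⟨n, hn⟩ := exists_nat_gt (M - c.re)
  obtain ⟨w, hw, hhw⟩ := hall n
  have hind := (LieModule.toEnd ℂ 𝔤 X h).independent_maxGenEigenspace
  have hdis : Disjoint ((LieModule.toEnd ℂ 𝔤 X h).maxGenEigenspace (c + n)) (eigenLE X h M) := by
    refine (hind (c + n)).mono_right (iSup₂_le fun d hd => le_iSup₂_of_le d ?_ le_rfl)
    rintro rfl
    simp at hd
    linarith
  rw [hM, disjoint_top, Submodule.eq_bot_iff] at hdis
  refine hw (hdis w ((Module.End.mem_maxGenEigenspace _ _ _).2 ⟨1, ?_⟩))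
  simp [hhw]

theorem exists_lie_eq_smul_of_finiteDimensional (h : 𝔤) (V : Submodule ℂ X)
    [FiniteDimensional ℂ V] (hV : ∀ v ∈ V, ⁅h, v⁆ ∈ V) (hV0 : V ≠ ⊥) :
    ∃ (c : ℂ) (v : X), v ≠ 0 ∧ ⁅h, v⁆ = c • v := by
  have : Nontrivial V := Submodule.nontrivial_iff_ne_bot.2 hV0
  obtain ⟨c, hc⟩ := Module.End.exists_eigenvalue ((LieModule.toEnd ℂ 𝔤 X h).restrict hV)
  obtain ⟨v, hv⟩ := hc.exists_hasEigenvector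
  exact ⟨c, v, by simpa using hv.2, congrArg Subtype.val hv.apply_eq_smul⟩

/-- Let `𝔤 = A ⊕ B₀ ⊕ B₁` be the decomposition into eigenspaces of `h` for the eigenvalues
`1`, `0`, `-1`. If the associated variety of `X` is Killing-orthogonal to `A`, then `X` contains
a nonzero vector annihilated by `A`. -/
theorem exists_lie_eq_zero_of_assocVariety [FiniteDimensional ℂ 𝔤] [LieAlgebra.IsKilling ℂ 𝔤]
    [Nontrivial X] {h : 𝔤} {A B₀ B₁ : Submodule ℂ 𝔤} (hA : ∀ a ∈ A, ⁅h, a⁆ = a)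
    (hB₀ : ∀ b ∈ B₀, ⁅h, b⁆ = 0) (hB₁ : ∀ b ∈ B₁, ⁅h, b⁆ = -b) (htop : A ⊔ (B₀ ⊔ B₁) = ⊤)
    (X₀ : Submodule ℂ X) [FiniteDimensional ℂ X₀] (hX₀ : ∀ v ∈ X₀, ⁅h, v⁆ ∈ X₀)
    (hgen : LieSubmodule.lieSpan ℂ 𝔤 (X₀ : Set X) = ⊤)
    (hAV : ∀ y ∈ assocVariety 𝔤 X₀, ∀ a ∈ A, killingForm ℂ 𝔤 y a = 0) :
    ∃ w : X, w ≠ 0 ∧ ∀ a ∈ A, ⁅a, w⁆ = 0 := by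
  obtain ⟨N, hN⟩ := exists_actPow_le_xFilPred A hAV
  obtain ⟨M, hM⟩ := le_eigenLE_of_finiteDimensional h X₀ hX₀
  have hX₀' : X₀ ≠ ⊥ := by
    rintro rfl
    have : (⊤ : LieSubmodule ℂ 𝔤 X) = ⊥ := by
      rw [← hgen, eq_bot_iff, LieSubmodule.lieSpan_le]
      simp
    exact top_ne_bot this
  obtain ⟨c, v, hv, hcv⟩ := exists_lie_eq_smul_of_finiteDimensional h X₀ hX₀ hX₀'
  have hpow : ∀ b : ℕ, actPow A X₀ b ≤ eigenLE X h (M + b) := by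
    intro b
    induction b with
    | zero => simpa [actPow] using hM
    | succ b ih =>
      refine actSpan_le.2 fun a ha w hw => ?_
      have := lie_mem_eigenLE (d := 1) (by rw [hA a ha, one_smul]) (ih hw)
      rwa [Complex.one_re, add_assoc, ← Nat.cast_succ] at this
  -- Fewer than `N` raisings from `X₀` stay below `M + N`; `B₀` preserves eigenvalues and `B₁`
  -- lowers them.
  have hstab : ∀ b ∈ B₀ ⊔ B₁, ∀ v ∈ eigenLE X h (M + N), ⁅b, v⁆ ∈ eigenLE X h (M + N) := by
    intro b hb w hw
    obtain ⟨b₀, hb₀, b₁, hb₁, rfl⟩ := Submodule.mem_sup.1 hb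
    rw [add_lie]
    refine Submodule.add_mem _ ?_ ?_
    · have := lie_mem_eigenLE (d := 0) (by rw [hB₀ b₀ hb₀, zero_smul]) hw
      rwa [Complex.zero_re, add_zero] at this
    · have := lie_mem_eigenLE (d := -1) (by rw [hB₁ b₁ hb₁, neg_smul, one_smul]) hw
      exact eigenLE_mono h (by simp) this
  have hE : eigenLE X h (M + N) = ⊤ := by
    rw [eq_top_iff, ← iSup_xFil_eq_top X₀ hgen]
    refine iSup_le (xFil_le_of_actPow_le htop hN (fun b hb => (hpow b).trans ?_) hstab)
    refine eigenLE_mono h ?_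
    gcongr
  exact exists_lie_eq_zero_of_eigenLE_eq_top hE hA hv hcv

end Grading

/-! ### Existence of one-parameter subgroups -/

section OneParameterSubgroups

variable {E : Type*} [NormedAddCommGroup E] [NormedSpace ℝ E] 
  {G : Type*} [TopologicalSpace G] [ChartedSpace E G] [Group G] [LieGroup 𝓘(ℝ, E) ∞ G]

theorem contMDiff_mulInvariantVectorField_one (x : GroupLieAlgebra 𝓘(ℝ, E) G) :
    ContMDiff 𝓘(ℝ, E) 𝓘(ℝ, E).tangent 1
      (fun g : G => (mulInvariantVectorField x g : TangentBundle 𝓘(ℝ, E) G)) := by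
  refine (contMDiff_mulInvariantVectorField x).of_le ?_
  rw [minSmoothness_of_isRCLikeNormedField]
  exact one_le_two

theorem mfderiv_mul_left_mulInvariantVectorField (x : GroupLieAlgebra 𝓘(ℝ, E) G) (g h : G) :
    mfderiv 𝓘(ℝ, E) 𝓘(ℝ, E) (fun y : G => g * y) h (mulInvariantVectorField x h) =
      mulInvariantVectorField x (g * h) := by
  have hd : ∀ g : G, MDifferentiable 𝓘(ℝ, E) 𝓘(ℝ, E) (fun y : G => g * y) := fun g =>
    (contMDiff_mul_left (I := 𝓘(ℝ, E)) (n := ∞)).mdifferentiable (by simp)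
  have h1 : (fun y : G => g * h * y) = (fun y => g * y) ∘ fun y => h * y := by
    ext y
    simp [mul_assoc]
  rw [mulInvariantVectorField, mulInvariantVectorField, h1]
  have := mfderiv_comp (1 : G) (hd g (h * 1)) (hd h 1)
  rw [this, mul_one]
  rfl

theorem isMIntegralCurveOn_mul_left {x : GroupLieAlgebra 𝓘(ℝ, E) G} {γ : ℝ → G} {s : Set ℝ}
    (hγ : IsMIntegralCurveOn (I := 𝓘(ℝ, E)) γ (mulInvariantVectorField x) s) (g : G) :
    IsMIntegralCurveOn (I := 𝓘(ℝ, E)) (fun t => g * γ t) (mulInvariantVectorField x) s := by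
  intro t ht
  have hd : MDifferentiableAt 𝓘(ℝ, E) 𝓘(ℝ, E) (fun y : G => g * y) (γ t) :=
    (contMDiff_mul_left (I := 𝓘(ℝ, E)) (n := ∞)).mdifferentiable (by simp) _
  have := hd.hasMFDerivAt.comp_hasMFDerivWithinAt t (hγ t ht)
  refine this.congr_mfderiv ?_
  refine ContinuousLinearMap.ext_ring ?_
  refine Eq.trans ?_ (Eq.trans (mfderiv_mul_left_mulInvariantVectorField x g (γ t)) ?_)
  · refine congrArg (mfderiv 𝓘(ℝ, E) 𝓘(ℝ, E) (fun y : G => g * y) (γ t)) ?_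
    exact one_smul ℝ _
  · exact (one_smul ℝ _).symm

variable [CompleteSpace E] [T2Space G]

/-- Left translates of one local integral curve through `1` run through every point for the same
time `ε`, and a uniform lifetime makes integral curves extend to all of `ℝ`. -/
theorem exists_isMIntegralCurve_mulInvariantVectorField (x : GroupLieAlgebra 𝓘(ℝ, E) G) :
    ∃ γ : ℝ → G, γ 0 = 1 ∧ IsMIntegralCurve (I := 𝓘(ℝ, E)) γ (mulInvariantVectorField x) := by
  have hv := contMDiff_mulInvariantVectorField_one x
  obtain ⟨γ, hγ0, hγ⟩ := exists_isMIntegralCurveAt_of_contMDiffAt_boundaryless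
    (I := 𝓘(ℝ, E)) (t₀ := 0) (hv.contMDiffAt (x := 1))
  obtain ⟨ε, hε, hγ⟩ := isMIntegralCurveAt_iff'.1 hγ
  rw [Real.ball_eq_Ioo, zero_sub, zero_add] at hγ
  exact exists_isMIntegralCurve_of_isMIntegralCurveOn hv hε
    (fun g => ⟨fun t => g * γ t, by simp [hγ0], isMIntegralCurveOn_mul_left hγ g⟩) 1

/-- Every element of the Lie algebra is the velocity of a one-parameter subgroup. -/
theorem exists_isOneParam (x : GroupLieAlgebra 𝓘(ℝ, E) G) : ∃ φ : ℝ → G, IsOneParam φ x := by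
  obtain ⟨γ, hγ0, hγ⟩ := exists_isMIntegralCurve_mulInvariantVectorField x
  refine ⟨γ, hγ0, fun s t => ?_, ?_⟩
  · have h1 : IsMIntegralCurve (I := 𝓘(ℝ, E)) (fun t => γ s * γ t)
        (mulInvariantVectorField x) := by
      rw [isMIntegralCurve_iff_isMIntegralCurveOn] at hγ ⊢
      exact isMIntegralCurveOn_mul_left hγ _
    have h2 := hγ.comp_add s
    -- The homomorphism law is uniqueness of integral curves: the translate by `γ s` and the time
    -- shift by `s` agree at `0`.
    have h3 := isMIntegralCurve_Ioo_eq_of_contMDiff_boundaryless (t₀ := 0)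
      (contMDiff_mulInvariantVectorField_one x) h1 h2 (by simp [hγ0])
    have := congrFun h3 t
    simp only [Function.comp_apply] at this
    rw [this, add_comm]
  · have h2 : ∀ g : G, g = 1 → (mulInvariantVectorField x g : E) = x := by
      rintro _ rfl
      have : (fun y : G => 1 * y) = id := by ext; simp
      rw [mulInvariantVectorField, this, mfderiv_id]
      rfl
    refine (hγ 0).congr_mfderiv ?_
    refine ContinuousLinearMap.ext_ring ?_
    refine Eq.trans (one_smul ℝ (mulInvariantVectorField x (γ 0) : E)) ?_
    rw [h2 _ hγ0]
    exact (one_smul ℝ (x : E)).symm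

end OneParameterSubgroups

theorem eq_zero_of_hasDerivAt_linear {n : ℕ} (A : Module.End ℂ (Fin n → ℂ))
    {u : ℝ → Fin n → ℂ} (hu : ∀ t, HasDerivAt u (A (u t)) t) (h0 : u 0 = 0) (t : ℝ) :
    u t = 0 := by
  have hA := (LinearMap.toContinuousLinearMap A).lipschitz
  have := ODE_solution_unique_univ (v := fun _ w => A w) (s := fun _ => Set.univ)
    (f := u) (g := 0) (t₀ := 0) (fun t => hA.lipschitzOnWith)
    (fun t => ⟨hu t, trivial⟩) (fun t => ⟨?_, trivial⟩) h0
  · exact congrFun this t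
  · simp

/-! ### Passing between `K`-stability and stability under Lie algebras -/

section GKModules

variable {E : Type*} [NormedAddCommGroup E] [NormedSpace ℝ E] [CompleteSpace E]
  {G : Type*} [TopologicalSpace G] [ChartedSpace E G] [Group G] [LieGroup 𝓘(ℝ, E) ∞ G]
  {θ : GroupLieAlgebra 𝓘(ℝ, E) G →ₗ⁅ℝ⁆ GroupLieAlgebra 𝓘(ℝ, E) G}
  {X : Type*} [AddCommGroup X] [Module ℂ X]
  [LieRingModule (gComplex E G) X] {π : Representation ℂ (maxK θ) X}

theorem mem_maxK_of_isOneParam {x : GroupLieAlgebra 𝓘(ℝ, E) G} (hx : x ∈ kReal θ) {φ : ℝ → G}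
    (hφ : IsOneParam φ x) (t : ℝ) : φ t ∈ maxK θ :=
  Subgroup.subset_closure ⟨x, φ, t, hx, hφ, rfl⟩

/-- A `K`-stable subspace is stable under `𝔨₀`. -/
theorem IsGKModule.tmul_lie_mem [T2Space G] (hπ : IsGKModule π) {W : Submodule ℂ X}
    (hW : IsStable π W) {x : GroupLieAlgebra 𝓘(ℝ, E) G} (hx : x ∈ kReal θ) {w : X} (hw : w ∈ W) :
    ⁅(1 : ℂ) ⊗ₜ[ℝ] x, w⁆ ∈ W := by
  obtain ⟨φ, hφ⟩ := exists_isOneParam x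
  by_contra hcon
  -- A functional vanishing on `W` is constantly zero along the orbit of `w`, so its derivative, the
  -- value at `x · w`, is zero as well.
  obtain ⟨f, hf, hfW⟩ := W.exists_dual_map_eq_bot_of_notMem hcon inferInstance
  have hfW' : ∀ v ∈ W, f v = 0 := fun v hv => by
    have : f v ∈ W.map f := Submodule.mem_map_of_mem hv
    rwa [hfW, Submodule.mem_bot] at this
  have h1 := hπ.differential x hx (fun t => ⟨φ t, mem_maxK_of_isOneParam hx hφ t⟩) hφ w f
  have h2 : (fun t => f (π (⟨φ t, mem_maxK_of_isOneParam hx hφ t⟩ : maxK θ) w)) = fun _ => 0 :=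
    funext fun t => hfW' _ (hW _ w hw)
  rw [h2] at h1
  exact hf (h1.unique (hasDerivAt_const _ _))

/-- The group law moves the derivative at time `0` to time `t`, giving the differential equation
that the orbit satisfies. -/
theorem IsGKModule.hasDerivAt (hπ : IsGKModule π) {x : GroupLieAlgebra 𝓘(ℝ, E) G}
    (hx : x ∈ kReal θ) {φ : ℝ → maxK θ} (hφ : IsOneParam (fun t => (φ t : G)) x) (v : X)
    (f : Module.Dual ℂ X) (t : ℝ) :
    HasDerivAt (fun t => f (π (φ t) v)) (f ⁅(1 : ℂ) ⊗ₜ[ℝ] x, π (φ t) v⁆) t := by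
  have h1 := hπ.differential x hx φ hφ (π (φ t) v) f
  have h2 : (fun t => f (π (φ t) v)) = fun r => f (π (φ (r - t)) (π (φ t) v)) := by
    funext r
    have h3 : φ r = φ (r - t) * φ t := by
      refine Subtype.ext (Eq.trans ?_ (hφ.map_add (r - t) t))
      rw [sub_add_cancel]
    rw [← Module.End.mul_apply, ← map_mul, ← h3]
  rw [h2]
  refine HasDerivAt.comp_sub_const (f := fun s => f (π (φ s) (π (φ t) v))) t t ?_
  rwa [sub_self]

variable [LieModule ℂ (gComplex E G) X]

theorem IsGKModule.lie_mem [T2Space G] (hπ : IsGKModule π) {W : Submodule ℂ X}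
    (hW : IsStable π W) {y : gComplex E G} (hy : y ∈ kComplex θ) {w : X} (hw : w ∈ W) :
    ⁅y, w⁆ ∈ W := by
  have hle : kComplex θ ≤
      W.comap ((LieModule.toEnd ℂ (gComplex E G) X : gComplex E G →ₗ[ℂ] Module.End ℂ X).flip w) := by
    rw [kComplex, Submodule.baseChange_eq_span, Submodule.span_le]
    rintro _ ⟨x, hx, rfl⟩
    exact hπ.tmul_lie_mem hW hx hw
  exact hle hy

/-- Modulo `N` the orbit of `v` is a curve in the finite-dimensional image of a `K`-stable `W`. It
solves a linear differential equation with initial value zero, so it vanishes. -/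
theorem IsGKModule.apply_mem_lieSubmodule [T2Space G] (hπ : IsGKModule π)
    (N : LieSubmodule ℂ (gComplex E G) X) {x : GroupLieAlgebra 𝓘(ℝ, E) G} (hx : x ∈ kReal θ)
    {φ : ℝ → maxK θ} (hφ : IsOneParam (fun t => (φ t : G)) x) (t : ℝ) {v : X} (hv : v ∈ N) :
    π (φ t) v ∈ N := by
  obtain ⟨W, hWfin, hW, hvW⟩ := hπ.locallyFinite v
  let N' : Submodule ℂ X := N
  let A : Module.End ℂ (X ⧸ N') := N'.mapQ N'
    (LieModule.toEnd ℂ (gComplex E G) X ((1 : ℂ) ⊗ₜ[ℝ] x)) fun w hw => N.lie_mem hw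
  let Q : Submodule ℂ (X ⧸ N') := W.map N'.mkQ
  have hAQ : ∀ q ∈ Q, A q ∈ Q := by
    rintro _ ⟨w, hw, rfl⟩
    exact ⟨_, hπ.tmul_lie_mem hW hx hw, rfl⟩
  let c : ℝ → Q := fun t => ⟨N'.mkQ (π (φ t) v), _, hW _ v hvW, rfl⟩
  let b := Module.finBasis ℂ Q
  let e := b.equivFun
  have hderiv : ∀ t, HasDerivAt (fun t => e (c t))
      ((e.toLinearMap ∘ₗ A.restrict hAQ ∘ₗ e.symm.toLinearMap) (e (c t))) t := by
    intro t
    rw [hasDerivAt_pi]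
    intro i
    obtain ⟨g, hg⟩ := (b.coord i).exists_extend
    have h := hπ.hasDerivAt hx hφ v (g ∘ₗ N'.mkQ) t
    have hg' : ∀ q : Q, e q i = g q := fun q => (DFunLike.congr_fun hg q).symm
    simp only [LinearMap.comp_apply, LinearEquiv.coe_coe, e.symm_apply_apply, hg']
    exact h
  have hzero := eq_zero_of_hasDerivAt_linear _ hderiv (by
    have : φ 0 = 1 := Subtype.ext hφ.map_zero
    have h0 : c 0 = 0 := by
      refine Subtype.ext ?_
      simp only [c, this, map_one, Module.End.one_apply]
      exact (Submodule.Quotient.mk_eq_zero N').2 hv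
    rw [h0, map_zero]) t
  have hct : c t = 0 := by simpa using hzero
  exact (Submodule.Quotient.mk_eq_zero N').1 (congrArg Subtype.val hct)

/-- Since `K` is connected, `𝔤`-submodules are `K`-stable. -/
theorem IsGKModule.isStable_lieSubmodule [T2Space G] (hπ : IsGKModule π)
    (N : LieSubmodule ℂ (gComplex E G) X) : IsStable π (N : Submodule ℂ X) := by
  -- Stability under inverses is carried along so that the inverse case of the closure induction is
  -- a swap.
  suffices h : ∀ (g : G) (hg : g ∈ maxK θ), (∀ w ∈ N, π ⟨g, hg⟩ w ∈ N) ∧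
      ∀ w ∈ N, π (⟨g, hg⟩ : maxK θ)⁻¹ w ∈ N from fun k => (h k k.2).1
  intro g hg
  induction hg using Subgroup.closure_induction with
  | mem g hg =>
    obtain ⟨x, φ, t, hx, hφ, rfl⟩ := hg
    have h := fun (s : ℝ) (w : X) (hw : w ∈ N) =>
      hπ.apply_mem_lieSubmodule N hx (φ := fun t => ⟨φ t, mem_maxK_of_isOneParam hx hφ t⟩) hφ s hw
    refine ⟨h t, fun w hw => ?_⟩
    have hinv : (⟨φ t, mem_maxK_of_isOneParam hx hφ t⟩ : maxK θ)⁻¹ =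
        ⟨φ (-t), mem_maxK_of_isOneParam hx hφ (-t)⟩ := by
      refine Subtype.ext (inv_eq_of_mul_eq_one_right ?_)
      rw [← hφ.map_add, add_neg_cancel, hφ.map_zero]
    rw [hinv]
    exact h (-t) w hw
  | one =>
    have : (⟨1, one_mem _⟩ : maxK θ) = 1 := rfl
    simp [this]
  | mul g g' hg hg' ih ih' =>
    have : (⟨g * g', mul_mem hg hg'⟩ : maxK θ) = ⟨g, hg⟩ * ⟨g', hg'⟩ := rfl
    rw [this, mul_inv_rev, map_mul, map_mul]
    exact ⟨fun w hw => ih.1 _ (ih'.1 w hw), fun w hw => ih'.2 _ (ih.2 w hw)⟩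
  | inv g hg ih =>
    have : (⟨g⁻¹, inv_mem hg⟩ : maxK θ) = ⟨g, hg⟩⁻¹ := rfl
    rw [this, inv_inv]
    exact ih.symm

end GKModules

/-! ### The element `z` inducing the complex structure -/

section RealHermitian

variable {L : Type*} [LieRing L] [LieAlgebra ℝ L] {θ : L →ₗ⁅ℝ⁆ L}

theorem IsCartanInvolution.isKilling (hθ : IsCartanInvolution θ) : LieAlgebra.IsKilling ℝ L := by
  constructor
  rw [LieSubmodule.eq_bot_iff]
  intro x hx
  by_contra hx0
  rw [LieIdeal.mem_killingCompl] at hx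
  have h1 := hθ.posDef x hx0
  have h2 := hx (θ x) trivial
  rw [LieModule.traceForm_comm] at h2
  have h3 : killingForm ℝ L x (θ x) = 0 := h2
  rw [h3] at h1
  simp at h1

theorem IsCartanInvolution.eq_zero_of_killingForm (hθ : IsCartanInvolution θ) {x : L}
    (h : killingForm ℝ L x (θ x) = 0) : x = 0 := by
  by_contra hx0
  have h1 := hθ.posDef x hx0
  rw [h] at h1
  simp at h1

/-- The projection of `𝔤₀` onto `𝔨₀`. -/
noncomputable def projK (hθ : IsCartanInvolution θ) : L →ₗ[ℝ] (kReal θ).toSubmodule :=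
  LinearMap.codRestrict _ ((1 / 2 : ℝ) • (LinearMap.id + (θ : L →ₗ[ℝ] L))) fun x => by
    change θ _ = _
    simp only [LinearMap.smul_apply, LinearMap.add_apply, LinearMap.id_apply, LieHom.coe_toLinearMap,
      map_smul, map_add, hθ.involutive]
    rw [add_comm]

/-- The projection of `𝔤₀` onto `𝔭₀`. -/
noncomputable def projP (hθ : IsCartanInvolution θ) : L →ₗ[ℝ] pReal θ :=
  LinearMap.codRestrict _ ((1 / 2 : ℝ) • (LinearMap.id - (θ : L →ₗ[ℝ] L))) fun x => by
    change θ _ = -_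
    simp only [LinearMap.smul_apply, LinearMap.sub_apply, LinearMap.id_apply, LieHom.coe_toLinearMap,
      map_smul, map_sub, hθ.involutive]
    rw [← smul_neg, neg_sub]

theorem projK_add_projP (hθ : IsCartanInvolution θ) (x : L) :
    (projK hθ x : L) + (projP hθ x : L) = x := by
  change (1 / 2 : ℝ) • (x + θ x) + (1 / 2 : ℝ) • (x - θ x) = x
  module

theorem projP_of_mem_kReal (hθ : IsCartanInvolution θ) {x : L} (hx : x ∈ kReal θ) :
    projP hθ x = 0 := by
  have hx' : θ x = x := hx
  refine Subtype.ext ?_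
  change (1 / 2 : ℝ) • (x - θ x) = 0
  rw [hx', sub_self, smul_zero]

theorem projP_coe (hθ : IsCartanInvolution θ) (x : pReal θ) : projP hθ x = x := by
  have hx' : θ x = -x := x.2
  refine Subtype.ext ?_
  change (1 / 2 : ℝ) • ((x : L) - θ x) = x
  rw [hx']
  module

theorem lie_mem_kReal_of_mem_pReal {x y : L} (hx : x ∈ pReal θ) (hy : y ∈ pReal θ) :
    ⁅x, y⁆ ∈ kReal θ := by
  have hx' : θ x = -x := hx
  have hy' : θ y = -y := hy
  change θ _ = _
  rw [LieHom.map_lie, hx', hy', neg_lie, lie_neg, neg_neg]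

variable {J : pReal θ →ₗ[ℝ] pReal θ}

/-- Both brackets lie in `𝔨₀`, where the Killing form is definite. Pairing with `k ∈ 𝔨₀`, invariance
moves `k` onto `y`; equivariance and orthogonality then remove `J`. -/
theorem IsHermitianStructure.lie_apply_apply (hθ : IsCartanInvolution θ)
    (hJ : IsHermitianStructure θ J) (x y : pReal θ) :
    ⁅(J x : L), (J y : L)⁆ = ⁅(x : L), (y : L)⁆ := by
  have hinv : ∀ a b c : L, killingForm ℝ L ⁅a, b⁆ c = killingForm ℝ L a ⁅b, c⁆ :=
    LieModule.traceForm_apply_lie_apply ℝ L L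
  have key : ∀ k ∈ kReal θ, killingForm ℝ L ⁅(J x : L), (J y : L)⁆ k =
      killingForm ℝ L ⁅(x : L), (y : L)⁆ k := by
    intro k hk
    have h1 := hJ.orthogonal x ⟨⁅k, (y : L)⁆, lie_mem_pReal hk y.2⟩
    rw [hJ.equivariant k hk y] at h1
    simp only at h1
    rw [hinv, hinv, ← lie_skew (J y : L) k, ← lie_skew (y : L) k, map_neg, map_neg, h1]
  have hk : ⁅(J x : L), (J y : L)⁆ - ⁅(x : L), (y : L)⁆ ∈ kReal θ :=
    sub_mem (lie_mem_kReal_of_mem_pReal (J x).2 (J y).2) (lie_mem_kReal_of_mem_pReal x.2 y.2)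
  refine sub_eq_zero.1 (hθ.eq_zero_of_killingForm ?_)
  rw [show θ _ = _ from hk, LinearMap.map_sub₂, key _ hk, sub_self]

/-- `J`, extended by `0` on `𝔨₀`, is a derivation. -/
noncomputable def jDerivation (hθ : IsCartanInvolution θ) (hJ : IsHermitianStructure θ J) :
    LieDerivation ℝ L L where
  toLinearMap := (pReal θ).subtype ∘ₗ J ∘ₗ projP hθ
  leibniz' a b := by
    have hkp : ∀ k ∈ kReal θ, ∀ y : pReal θ, (J (projP hθ ⁅k, (y : L)⁆) : L) = ⁅k, (J y : L)⁆ := by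
      intro k hk y
      have h1 := projP_coe hθ ⟨⁅k, (y : L)⁆, lie_mem_pReal hk y.2⟩
      simp only at h1
      rw [h1, hJ.equivariant k hk y]
    have hkk : ∀ k ∈ kReal θ, projP hθ k = 0 := fun k hk => projP_of_mem_kReal hθ hk
    have hpp : ∀ x y : pReal θ, ⁅(x : L), (J y : L)⁆ - ⁅(y : L), (J x : L)⁆ = 0 := by
      intro x y
      have h1 := hJ.lie_apply_apply hθ x (J y)
      rw [hJ.sq, Submodule.coe_neg, lie_neg] at h1
      rw [← h1, ← lie_skew (y : L)]
      abel
    simp only [LinearMap.comp_apply, Submodule.subtype_apply]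
    obtain ⟨k, x, hk, rfl, hkx⟩ : ∃ (k : L) (x : pReal θ), k ∈ kReal θ ∧ k + x = a ∧
        projP hθ a = x := ⟨_, _, (projK hθ a).2, projK_add_projP hθ a, rfl⟩
    obtain ⟨l, y, hl, rfl, hly⟩ : ∃ (l : L) (y : pReal θ), l ∈ kReal θ ∧ l + y = b ∧
        projP hθ b = y := ⟨_, _, (projK hθ b).2, projK_add_projP hθ b, rfl⟩
    rw [hkx, hly]
    simp only [add_lie, lie_add, map_add, Submodule.coe_add]
    rw [hkk _ ((kReal θ).lie_mem hk hl), hkk _ (lie_mem_kReal_of_mem_pReal x.2 y.2), hkp k hk y,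
      ← lie_skew (x : L) l, map_neg, map_neg, Submodule.coe_neg, hkp l hl x, map_zero,
      ZeroMemClass.coe_zero]
    rw [sub_eq_zero.1 (hpp x y)]
    abel

/-- `z` is the element of the center of `𝔨₀` that acts on `𝔭₀` as `J`. -/
structure IsComplexStructureElement (J : pReal θ →ₗ[ℝ] pReal θ) (z : L) : Prop where
  mem_kReal : z ∈ kReal θ
  lie_kReal : ∀ x ∈ kReal θ, ⁅z, x⁆ = 0
  lie_pReal : ∀ x : pReal θ, ⁅z, (x : L)⁆ = J x

/-- `z` is the element whose inner derivation is `jDerivation`. It is fixed by `θ` because `θ z` has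
the same adjoint action and the center is zero. -/
theorem exists_isComplexStructureElement [FiniteDimensional ℝ L] (hθ : IsCartanInvolution θ)
    (hJ : IsHermitianStructure θ J) : ∃ z : L, IsComplexStructureElement J z := by
  have := hθ.isKilling
  obtain ⟨z, hz⟩ := LieDerivation.IsKilling.exists_eq_ad (jDerivation hθ hJ)
  have hz' : ∀ x, ⁅z, x⁆ = (J (projP hθ x) : L) := fun x => by
    rw [← LieAlgebra.ad_apply ℝ, ← LieDerivation.coe_ad_apply_eq_ad_apply, hz]
    rfl
  have hk : ∀ x ∈ kReal θ, ⁅z, x⁆ = 0 := fun x hx => by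
    rw [hz', projP_of_mem_kReal hθ hx, map_zero, ZeroMemClass.coe_zero]
  have hp : ∀ x : pReal θ, ⁅z, (x : L)⁆ = J x := fun x => by rw [hz', projP_coe]
  refine ⟨z, ?_, hk, hp⟩
  have hθz : ∀ x : L, ⁅θ z - z, x⁆ = 0 := by
    intro x
    have hx := projK_add_projP hθ x
    have h1 : θ (projK hθ x : L) = projK hθ x := (projK hθ x).2
    have h2 : θ (projP hθ x : L) = -projP hθ x := (projP hθ x).2
    have h3 : θ (J (projP hθ x) : L) = -J (projP hθ x) := (J (projP hθ x)).2
    have h4 : ⁅θ z, (projK hθ x : L)⁆ = 0 := by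
      rw [← h1, ← LieHom.map_lie, hk _ (projK hθ x).2, map_zero]
    have h5 : ⁅θ z, (projP hθ x : L)⁆ = J (projP hθ x) := by
      rw [← neg_neg (projP hθ x : L), ← h2, lie_neg, ← LieHom.map_lie, hp, h3, neg_neg]
    rw [← hx, sub_lie, lie_add, lie_add, h4, h5, hk _ (projK hθ x).2, hp, sub_self]
  have : θ z - z = 0 := by
    have hmem : θ z - z ∈ LieAlgebra.center ℝ L := by
      rw [LieModule.mem_maxTrivSubmodule]
      intro x
      rw [← lie_skew, hθz, neg_zero]
    rwa [LieAlgebra.center_eq_bot, LieSubmodule.mem_bot] at hmem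
  exact sub_eq_zero.1 this

variable {z : L}

theorem IsComplexStructureElement.lie_eq (hθ : IsCartanInvolution θ)
    (hz : IsComplexStructureElement J z) (x : L) : ⁅z, x⁆ = J (projP hθ x) := by
  conv_lhs => rw [← projK_add_projP hθ x]
  rw [lie_add, hz.lie_kReal _ (projK hθ x).2, zero_add, hz.lie_pReal]

/-- `J` is injective, so an element commuting with `z` has no `𝔭₀`-component. -/
theorem IsComplexStructureElement.mem_kReal_of_lie_eq_zero (hθ : IsCartanInvolution θ)
    (hJ : IsHermitianStructure θ J) (hz : IsComplexStructureElement J z) {x : L}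
    (hx : ⁅z, x⁆ = 0) : x ∈ kReal θ := by
  rw [hz.lie_eq hθ, ZeroMemClass.coe_eq_zero] at hx
  have h1 := hJ.sq (projP hθ x)
  rw [hx, map_zero, zero_eq_neg] at h1
  have := projK_add_projP hθ x
  rw [h1, ZeroMemClass.coe_zero, add_zero] at this
  rw [← this]
  exact (projK hθ x).2

end RealHermitian

/-! ### Complexification and the eigenspaces of `ad z` -/

section Complexification

variable {L : Type*} [LieRing L] [LieAlgebra ℝ L]

theorem exists_eq_one_tmul_add_I_tmul {V : Type*} [AddCommGroup V] [Module ℝ V] (w : ℂ ⊗[ℝ] V) :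
    ∃ a b : V, w = (1 : ℂ) ⊗ₜ[ℝ] a + Complex.I ⊗ₜ[ℝ] b := by
  induction w with
  | zero => exact ⟨0, 0, by simp⟩
  | tmul c x =>
    refine ⟨c.re • x, c.im • x, ?_⟩
    rw [← TensorProduct.smul_tmul, ← TensorProduct.smul_tmul, ← TensorProduct.add_tmul]
    congr 1
    apply Complex.ext <;> simp
  | add u v hu hv =>
    obtain ⟨a, b, rfl⟩ := hu
    obtain ⟨a', b', rfl⟩ := hv
    exact ⟨a + a', b + b', by rw [TensorProduct.tmul_add, TensorProduct.tmul_add]; abel⟩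

theorem mem_of_one_tmul_add_I_tmul_mem {V : Type*} [AddCommGroup V] [Module ℝ V]
    {S : Submodule ℝ V} {a b : V}
    (h : (1 : ℂ) ⊗ₜ[ℝ] a + Complex.I ⊗ₜ[ℝ] b ∈ S.baseChange ℂ) : a ∈ S ∧ b ∈ S := by
  have key : ∀ f : Module.Dual ℝ V, (∀ s ∈ S, f s = 0) → f a = 0 ∧ f b = 0 := by
    intro f hf
    -- The complexified functional takes the value `f a + i f b`, so its vanishing separates into
    -- real and imaginary parts.
    let F : ℂ ⊗[ℝ] V →ₗ[ℂ] ℂ := LinearMap.liftBaseChange ℂ (Complex.ofRealCLM.toLinearMap ∘ₗ f)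
    have hle : S.baseChange ℂ ≤ LinearMap.ker F := by
      rw [Submodule.baseChange_eq_span, Submodule.span_le]
      rintro _ ⟨s, hs, rfl⟩
      simp [F, hf s hs]
    have h1 : F _ = 0 := hle h
    simp only [F, map_add, LinearMap.liftBaseChange_tmul, LinearMap.comp_apply] at h1
    have hre := congrArg Complex.re h1
    have him := congrArg Complex.im h1
    simp at hre him
    exact ⟨hre, him⟩
  constructor
  · by_contra hcon
    obtain ⟨f, hf, hfS⟩ := S.exists_dual_map_eq_bot_of_notMem hcon inferInstance
    refine hf (key f fun s hs => ?_).1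
    have : f s ∈ S.map f := Submodule.mem_map_of_mem hs
    rwa [hfS, Submodule.mem_bot] at this
  · by_contra hcon
    obtain ⟨f, hf, hfS⟩ := S.exists_dual_map_eq_bot_of_notMem hcon inferInstance
    refine hf (key f fun s hs => ?_).2
    have : f s ∈ S.map f := Submodule.mem_map_of_mem hs
    rwa [hfS, Submodule.mem_bot] at this

theorem isKilling_complexification [FiniteDimensional ℝ L] [LieAlgebra.IsKilling ℝ L] :
    LieAlgebra.IsKilling ℂ (ℂ ⊗[ℝ] L) := by
  constructor
  rw [LieSubmodule.eq_bot_iff]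
  intro w hw
  rw [LieIdeal.mem_killingCompl] at hw
  obtain ⟨a, b, rfl⟩ := exists_eq_one_tmul_add_I_tmul w
  have hab : ∀ x, killingForm ℝ L x a = 0 ∧ killingForm ℝ L x b = 0 := by
    intro x
    have h1 := hw ((1 : ℂ) ⊗ₜ x) trivial
    rw [show killingForm ℂ (ℂ ⊗[ℝ] L) = (killingForm ℝ L).baseChange ℂ from
      LieModule.traceForm_baseChange .., map_add, LinearMap.BilinForm.baseChange_tmul,
      LinearMap.BilinForm.baseChange_tmul] at h1
    have hre := congrArg Complex.re h1
    have him := congrArg Complex.im h1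
    simp at hre him
    exact ⟨hre, him⟩
  have hnd := (LieAlgebra.IsKilling.killingForm_nondegenerate ℝ L).2
  rw [hnd a fun x => (hab x).1, hnd b fun x => (hab x).2]
  simp

variable {θ : L →ₗ⁅ℝ⁆ L} {J : pReal θ →ₗ[ℝ] pReal θ} {z : L}

/-- The adjoint action of `𝔤₀` on its complexification. -/
noncomputable abbrev adC (z : L) : Module.End ℂ (ℂ ⊗[ℝ] L) :=
  LieAlgebra.ad ℂ (ℂ ⊗[ℝ] L) ((1 : ℂ) ⊗ₜ[ℝ] z)

theorem adC_eq_baseChange (z : L) (w : ℂ ⊗[ℝ] L) :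
    adC z w = (LieAlgebra.ad ℝ L z).baseChange ℂ w :=
  DFunLike.congr_fun (LieModule.toEnd_baseChange ℝ ℂ L L z) w

theorem ad_ad_apply {𝔤 : Type*} [LieRing 𝔤] [LieAlgebra ℂ 𝔤] (x y w : 𝔤) :
    LieAlgebra.ad ℂ 𝔤 x (LieAlgebra.ad ℂ 𝔤 y w) =
      LieAlgebra.ad ℂ 𝔤 (LieAlgebra.ad ℂ 𝔤 x y) w + LieAlgebra.ad ℂ 𝔤 y (LieAlgebra.ad ℂ 𝔤 x w) :=
  leibniz_lie x y w

theorem lie_of_mem_pPlus (hz : IsComplexStructureElement J z) {w : ℂ ⊗[ℝ] L} (hw : w ∈ pPlus J) :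
    adC z w = Complex.I • w := by
  obtain ⟨u, hu, rfl⟩ := hw
  have h1 : LieAlgebra.ad ℝ L z ∘ₗ (pReal θ).subtype = (pReal θ).subtype ∘ₗ J :=
    LinearMap.ext fun x => hz.lie_pReal x
  have h2 : J.baseChange ℂ u = Complex.I • u := Module.End.mem_eigenspace_iff.1 hu
  rw [adC_eq_baseChange, ← LinearMap.comp_apply, ← LinearMap.baseChange_comp, h1,
    LinearMap.baseChange_comp, LinearMap.comp_apply, h2, map_smul]

/-- The projection to `𝔭₀` is `-(ad z)²`, which acts as the identity on an `i`-eigenvector of `ad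
z`. -/
theorem mem_pPlus_of_lie (hθ : IsCartanInvolution θ) (hJ : IsHermitianStructure θ J)
    (hz : IsComplexStructureElement J z) {w : ℂ ⊗[ℝ] L}
    (hw : adC z w = Complex.I • w) : w ∈ pPlus J := by
  rw [adC_eq_baseChange] at hw
  have h1 : (pReal θ).subtype ∘ₗ projP hθ = -(LieAlgebra.ad ℝ L z ∘ₗ LieAlgebra.ad ℝ L z) := by
    refine LinearMap.ext fun x => ?_
    change (projP hθ x : L) = -⁅z, ⁅z, x⁆⁆
    rw [hz.lie_eq hθ x, hz.lie_pReal, hJ.sq, Submodule.coe_neg, neg_neg]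
  have h2 : J ∘ₗ projP hθ = projP hθ ∘ₗ LieAlgebra.ad ℝ L z := by
    refine LinearMap.ext fun x => ?_
    change J (projP hθ x) = projP hθ ⁅z, x⁆
    rw [hz.lie_eq hθ x, projP_coe]
  refine ⟨(projP hθ).baseChange ℂ w, ?_, ?_⟩
  · rw [SetLike.mem_coe, Module.End.mem_eigenspace_iff, ← LinearMap.comp_apply,
      ← LinearMap.baseChange_comp, h2, LinearMap.baseChange_comp, LinearMap.comp_apply, hw,
      map_smul]
  · rw [← LinearMap.comp_apply, ← LinearMap.baseChange_comp, h1, LinearMap.baseChange_neg,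
      LinearMap.baseChange_comp, LinearMap.neg_apply, LinearMap.comp_apply, hw, map_smul, hw,
      smul_smul, Complex.I_mul_I, neg_smul, one_smul, neg_neg]

theorem lie_of_mem_kComplex (hz : IsComplexStructureElement J z) {w : ℂ ⊗[ℝ] L}
    (hw : w ∈ kComplex θ) : adC z w = 0 := by
  obtain ⟨u, rfl⟩ := hw
  have h1 : LieAlgebra.ad ℝ L z ∘ₗ (kReal θ).toSubmodule.subtype = 0 :=
    LinearMap.ext fun x => hz.lie_kReal x x.2
  rw [adC_eq_baseChange, ← LinearMap.comp_apply, ← LinearMap.baseChange_comp, h1,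
    LinearMap.baseChange_zero, LinearMap.zero_apply]

theorem mem_kComplex_of_lie (hθ : IsCartanInvolution θ) (hJ : IsHermitianStructure θ J)
    (hz : IsComplexStructureElement J z) {w : ℂ ⊗[ℝ] L}
    (hw : adC z w = 0) : w ∈ kComplex θ := by
  rw [adC_eq_baseChange] at hw
  have h1 : (kReal θ).toSubmodule.subtype ∘ₗ projK hθ =
      LinearMap.id + LieAlgebra.ad ℝ L z ∘ₗ LieAlgebra.ad ℝ L z := by
    refine LinearMap.ext fun x => ?_
    change (projK hθ x : L) = x + ⁅z, ⁅z, x⁆⁆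
    rw [hz.lie_eq hθ x, hz.lie_pReal, hJ.sq, Submodule.coe_neg, ← sub_eq_add_neg, eq_sub_iff_add_eq,
      projK_add_projP]
  refine ⟨(projK hθ).baseChange ℂ w, ?_⟩
  rw [← LinearMap.comp_apply, ← LinearMap.baseChange_comp, h1, LinearMap.baseChange_add,
    LinearMap.baseChange_comp, LinearMap.add_apply, LinearMap.comp_apply, hw, map_zero, add_zero,
    LinearMap.baseChange_id, LinearMap.id_apply]

theorem lie_lie_lie_eq_neg (hθ : IsCartanInvolution θ) (hJ : IsHermitianStructure θ J)
    (hz : IsComplexStructureElement J z) (w : ℂ ⊗[ℝ] L) :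
    adC z (adC z (adC z w)) = -adC z w := by
  have h1 : LieAlgebra.ad ℝ L z ∘ₗ LieAlgebra.ad ℝ L z ∘ₗ LieAlgebra.ad ℝ L z =
      -LieAlgebra.ad ℝ L z := by
    refine LinearMap.ext fun x => ?_
    change ⁅z, ⁅z, ⁅z, x⁆⁆⁆ = -⁅z, x⁆
    rw [hz.lie_eq hθ x, hz.lie_pReal, hz.lie_pReal, hJ.sq, Submodule.coe_neg]
  have h2 := congrArg (LinearMap.baseChange ℂ) h1
  rw [LinearMap.baseChange_comp, LinearMap.baseChange_comp, LinearMap.baseChange_neg] at h2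
  simp only [adC_eq_baseChange]
  exact DFunLike.congr_fun h2 w

/-- The `-i`-eigenspace `𝔭₋` of `J`, as an eigenspace of the element `z`. -/
noncomputable def pMinus (z : L) : Submodule ℂ (ℂ ⊗[ℝ] L) :=
  Module.End.eigenspace (adC z) (-Complex.I)

theorem lie_of_mem_pMinus {w : ℂ ⊗[ℝ] L} (hw : w ∈ pMinus z) :
    adC z w = -Complex.I • w :=
  Module.End.mem_eigenspace_iff.1 hw

theorem pPlus_sup_kComplex_sup_pMinus (hθ : IsCartanInvolution θ) (hJ : IsHermitianStructure θ J)
    (hz : IsComplexStructureElement J z) : pPlus J ⊔ (kComplex θ ⊔ pMinus z) = ⊤ := by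
  rw [eq_top_iff]
  intro w _
  have h3 : adC z (adC z (adC z w)) = -adC z w := lie_lie_lie_eq_neg hθ hJ hz w
  -- These are the Lagrange projectors of `T³ + T = 0` at the roots `i`, `0`, `-i`, with `T = ad z`.
  have hw : w = (-(1 / 2 : ℂ)) • (adC z (adC z w) + Complex.I • adC z w) + ((w + adC z (adC z w)) +
      (-(1 / 2 : ℂ)) • (adC z (adC z w) - Complex.I • adC z w)) := by module
  rw [hw]
  refine Submodule.add_mem_sup (Submodule.smul_mem _ _ (mem_pPlus_of_lie hθ hJ hz ?_))
    (Submodule.add_mem_sup (mem_kComplex_of_lie hθ hJ hz ?_)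
    (Submodule.smul_mem _ _ (Module.End.mem_eigenspace_iff.2 ?_)))
  · rw [map_add, map_smul, h3, smul_add, smul_smul, Complex.I_mul_I]
    module
  · rw [map_add, h3, add_neg_cancel]
  · rw [map_sub, map_smul, h3, smul_sub, smul_smul, neg_mul,
      Complex.I_mul_I]
    module

/-- Invariance under `ad z` gives `i B(x, y) = -i B(x, y)`. -/
theorem killingForm_pPlus (hz : IsComplexStructureElement J z) {x y : ℂ ⊗[ℝ] L}
    (hx : x ∈ pPlus J) (hy : y ∈ pPlus J) : killingForm ℂ (ℂ ⊗[ℝ] L) x y = 0 := by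
  have h := LieModule.traceForm_apply_lie_apply' ℂ (ℂ ⊗[ℝ] L) (ℂ ⊗[ℝ] L) ((1 : ℂ) ⊗ₜ[ℝ] z) x y
  rw [show ⁅(1 : ℂ) ⊗ₜ[ℝ] z, x⁆ = _ from lie_of_mem_pPlus hz hx,
    show ⁅(1 : ℂ) ⊗ₜ[ℝ] z, y⁆ = _ from lie_of_mem_pPlus hz hy, map_smul, LinearMap.smul_apply, map_smul,
    self_eq_neg] at h
  simpa using h

theorem lie_mem_pPlus (hθ : IsCartanInvolution θ) (hJ : IsHermitianStructure θ J)
    (hz : IsComplexStructureElement J z) {x y : ℂ ⊗[ℝ] L} (hx : x ∈ kComplex θ)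
    (hy : y ∈ pPlus J) : LieAlgebra.ad ℂ (ℂ ⊗[ℝ] L) x y ∈ pPlus J := by
  refine mem_pPlus_of_lie hθ hJ hz ?_
  rw [ad_ad_apply, lie_of_mem_kComplex hz hx, map_zero, LinearMap.zero_apply, zero_add,
    lie_of_mem_pPlus hz hy, map_smul]

end Complexification

/-! ### Positive systems and highest weight vectors -/

section HighestWeight

variable {𝔤 : Type*} [LieRing 𝔤] [LieAlgebra ℂ 𝔤]
  {𝔥 : LieSubalgebra ℂ 𝔤} [𝔥.IsCartanSubalgebra] {P : Set (Module.Dual ℂ 𝔥)}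

/-- A root as a nonzero weight of `𝔤`. -/
def IsRoot.toWeight {α : Module.Dual ℂ 𝔥} (hα : IsRoot 𝔥 α) : LieModule.Weight ℂ 𝔥 𝔤 :=
  ⟨α, hα.2⟩

theorem IsRoot.isNonZero {α : Module.Dual ℂ 𝔥} (hα : IsRoot 𝔥 α) : hα.toWeight.IsNonZero :=
  fun h => hα.1 (LinearMap.ext fun x => congrFun h x)

theorem IsPositiveSystem.neg_notMem (hP : IsPositiveSystem 𝔥 P) {α : Module.Dual ℂ 𝔥}
    (hα : α ∈ P) : -α ∉ P :=
  (hP.trichotomy α (hP.isRoot α hα)).1 hα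

variable [FiniteDimensional ℂ 𝔤]

theorem isRoot_of_weight (w : LieModule.Weight ℂ 𝔥 𝔤) (hw : w.IsNonZero) : IsRoot 𝔥 w.toLinear :=
  ⟨fun h => hw (funext fun x => DFunLike.congr_fun h x), w.genWeightSpace_ne_bot⟩

variable [LieAlgebra.IsKilling ℂ 𝔤]

theorem IsRoot.neg {α : Module.Dual ℂ 𝔥} (hα : IsRoot 𝔥 α) : IsRoot 𝔥 (-α) :=
  ⟨neg_ne_zero.2 hα.1, (-hα.toWeight).genWeightSpace_ne_bot⟩

/-- If `α ≠ -β` are roots with `⟨β, α^∨⟩ < 0`, then `β + α` is a root. -/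
theorem IsRoot.add {α β : Module.Dual ℂ 𝔥} (hα : IsRoot 𝔥 α) (hβ : IsRoot 𝔥 β) (h : β ≠ -α)
    (hneg : (β (LieAlgebra.IsKilling.coroot hα.toWeight)).re < 0) : IsRoot 𝔥 (β + α) := by
  let i : 𝔥.root := ⟨hβ.toWeight, by simpa using hβ.isNonZero⟩
  let j : 𝔥.root := ⟨hα.toWeight, by simpa using hα.isNonZero⟩
  have h1 : ((LieAlgebra.IsKilling.rootSystem 𝔥).pairingIn ℤ i j : ℂ) =
      β (LieAlgebra.IsKilling.coroot hα.toWeight) :=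
    (LieAlgebra.IsKilling.rootSystem 𝔥).algebraMap_pairingIn ℤ i j
  have h2 : (LieAlgebra.IsKilling.rootSystem 𝔥).pairingIn ℤ i j < 0 := by
    rw [← h1, Complex.intCast_re] at hneg
    exact_mod_cast hneg
  obtain ⟨k, hk⟩ := RootPairing.root_add_root_mem_of_pairingIn_neg _ h2 h
  have hk' : (k : LieModule.Weight ℂ 𝔥 𝔤).toLinear = β + α := hk
  rw [← hk']
  exact isRoot_of_weight _ (LieSubalgebra.isNonZero_coe_root k)

/-- A nonempty sum of positive roots is nonzero. -/
theorem IsPositiveSystem.sum_ne_zero (hP : IsPositiveSystem 𝔥 P)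
    (s : Multiset (Module.Dual ℂ 𝔥)) (hs : s ≠ 0) (hsP : ∀ α ∈ s, α ∈ P) : s.sum ≠ 0 := by
  induction hn : s.card using Nat.strong_induction_on generalizing s with
  | _ n ih =>
    intro hsum
    obtain ⟨α, hαs⟩ := Multiset.exists_mem_of_ne_zero hs
    obtain ⟨t, rfl⟩ := Multiset.exists_cons_of_mem hαs
    have hα := hP.isRoot α (hsP α hαs)
    let f : Module.Dual ℂ 𝔥 →+ ℝ :=
      { toFun := fun β => (β (LieAlgebra.IsKilling.coroot hα.toWeight)).re
        map_zero' := by simp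
        map_add' := by simp }
    -- Since `f α = 2` and the total is zero, some other summand pairs negatively with the coroot of
    -- `α`. Merging it with `α` into one positive root shortens the vanishing sum.
    obtain ⟨β, hβt, hβneg⟩ : ∃ β ∈ t, f β < 0 := by
      by_contra! hcon
      have h1 := congrArg f hsum
      rw [Multiset.sum_cons, map_add, map_multiset_sum, map_zero] at h1
      have h2 : f α = 2 := by
        have : α (LieAlgebra.IsKilling.coroot hα.toWeight) = 2 :=
          LieAlgebra.IsKilling.root_apply_coroot hα.isNonZero
        simp [f, this]
      have h3 : 0 ≤ (t.map f).sum := by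
        refine Multiset.sum_nonneg fun x hx => ?_
        obtain ⟨β, hβ, rfl⟩ := Multiset.mem_map.1 hx
        exact hcon β hβ
      linarith
    obtain ⟨u, rfl⟩ := Multiset.exists_cons_of_mem hβt
    have hβP : β ∈ P := hsP β (by simp)
    have hβ := hP.isRoot β hβP
    have hne : β ≠ -α := by
      rintro rfl
      exact hP.neg_notMem (hsP α hαs) hβP
    have hsumP := hP.add_mem β hβP α (hsP α hαs) (hα.add hβ hne hβneg)
    refine ih (((β + α) ::ₘ u).card) ?_ ((β + α) ::ₘ u) (Multiset.cons_ne_zero) ?_ rfl ?_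
    · rw [← hn]
      simp
    · intro γ hγ
      rcases Multiset.mem_cons.1 hγ with rfl | hγ
      · exact hsumP
      · exact hsP γ (by simp [hγ])
    · rw [← hsum]
      simp only [Multiset.sum_cons]
      abel

variable {X : Type*} [AddCommGroup X] [Module ℂ X] [LieRingModule 𝔤 X] [LieModule ℂ 𝔤 X]

/-- The theorem of the highest weight vector: a finite-dimensional nonzero subspace that is stable
under `𝔥` and the positive root vectors contains a weight vector killed by the latter. -/
theorem IsPositiveSystem.exists_highestWeightVector (hP : IsPositiveSystem 𝔥 P)
    (W : Submodule ℂ X) [FiniteDimensional ℂ W] (hW0 : W ≠ ⊥)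
    (hWh : ∀ H : 𝔥, ∀ w ∈ W, ⁅(H : 𝔤), w⁆ ∈ W)
    (hWP : ∀ α ∈ P, ∀ e ∈ LieAlgebra.rootSpace 𝔥 (α : 𝔥 → ℂ), ∀ w ∈ W, ⁅(e : 𝔤), w⁆ ∈ W) :
    ∃ v ∈ W, ∃ lam : Module.Dual ℂ 𝔥, v ≠ 0 ∧ (∀ H : 𝔥, ⁅(H : 𝔤), v⁆ = lam H • v) ∧
      ∀ α ∈ P, ∀ e ∈ LieAlgebra.rootSpace 𝔥 (α : 𝔥 → ℂ), ⁅(e : 𝔤), v⁆ = 0 := by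
  let W' : LieSubmodule ℂ 𝔥 X := { W with lie_mem := fun {H w} hw => hWh H w hw }
  have : FiniteDimensional ℂ W' := ‹FiniteDimensional ℂ W›
  have : Nontrivial W' := Submodule.nontrivial_iff_ne_bot.2 hW0
  let Λ : Set (Module.Dual ℂ 𝔥) :=
    {lam | ∃ w ∈ W, w ≠ 0 ∧ ∀ H : 𝔥, ⁅(H : 𝔤), w⁆ = lam H • w}
  have hΛfin : Λ.Finite := by
    refine Set.Finite.of_finite_image (f := fun lam => (lam : 𝔥 → ℂ))
      ((LieModule.finite_genWeightSpace_ne_bot ℂ 𝔥 W').subset ?_) DFunLike.coe_injective.injOn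
    rintro _ ⟨lam, ⟨w, hw, hw0, hwlam⟩, rfl⟩
    rw [Set.mem_ofPred_eq]
    intro hbot
    have hmem : (⟨w, hw⟩ : W') ∈ LieModule.genWeightSpace W' (lam : 𝔥 → ℂ) := by
      refine LieModule.weightSpace_le_genWeightSpace W' _ ?_
      rw [LieModule.mem_weightSpace]
      exact fun H => Subtype.ext (hwlam H)
    rw [hbot, LieSubmodule.mem_bot] at hmem
    exact hw0 (congrArg Subtype.val hmem)
  have hΛne : Λ.Nonempty := by
    obtain ⟨χ, hχ⟩ := LieModule.exists_nontrivial_weightSpace_of_isNilpotent ℂ 𝔥 W'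
    obtain ⟨⟨w, hw⟩, hw0⟩ := exists_ne (0 : LieModule.weightSpace W' χ)
    rw [LieModule.mem_weightSpace] at hw
    exact ⟨χ, w, w.2, fun h => hw0 (Subtype.ext (Subtype.ext h)),
      fun H => congrArg Subtype.val (hw H)⟩
  have : Finite Λ := hΛfin
  -- `r μ ν` means that `μ` is strictly higher than `ν`, so an `r`-minimal element is a maximal
  -- weight. Irreflexivity is `sum_ne_zero`.
  let r : Λ → Λ → Prop := fun μ ν => ∃ s : Multiset (Module.Dual ℂ 𝔥), s ≠ 0 ∧
    (∀ α ∈ s, α ∈ P) ∧ (μ : Module.Dual ℂ 𝔥) = ν + s.sum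
  have htrans : IsTrans Λ r := ⟨by
    rintro a b c ⟨s, hs, hsP, hab⟩ ⟨t, ht, htP, hbc⟩
    refine ⟨s + t, fun h => hs (add_eq_zero.1 h).1, fun α hα => ?_, ?_⟩
    · rcases Multiset.mem_add.1 hα with h | h
      exacts [hsP α h, htP α h]
    · rw [hab, hbc, Multiset.sum_add]
      abel⟩
  have hirrefl : Std.Irrefl r := ⟨by
    rintro a ⟨s, hs, hsP, h⟩
    exact hP.sum_ne_zero s hs hsP (by simpa using h)⟩
  obtain ⟨⟨lam, v, hvW, hv0, hvlam⟩, -, hmax⟩ :=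
    (Finite.wellFounded_of_trans_of_irrefl r).has_min Set.univ
      ⟨⟨hΛne.choose, hΛne.choose_spec⟩, trivial⟩
  refine ⟨v, hvW, lam, hv0, hvlam, fun α hα e he => ?_⟩
  by_contra hev
  have hmem : lam + α ∈ Λ := by
    refine ⟨⁅e, v⁆, hWP α hα e he v hvW, hev, fun H => ?_⟩
    have h1 : ⁅(H : 𝔤), e⁆ = α H • e := LieAlgebra.IsKilling.lie_eq_smul_of_mem_rootSpace he H
    rw [leibniz_lie, h1, hvlam, smul_lie, lie_smul, LinearMap.add_apply, add_smul, add_comm]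
  refine hmax ⟨lam + α, hmem⟩ trivial ⟨{α}, by simp, ?_, by simp⟩
  intro β hβ
  rwa [Multiset.mem_singleton.1 hβ]

end HighestWeight

/-! ### Cartan subalgebras in `𝔨` and adapted positive systems -/

section AdaptedPairs

variable {L : Type*} [LieRing L] [LieAlgebra ℝ L] {θ : L →ₗ⁅ℝ⁆ L}
  {J : pReal θ →ₗ[ℝ] pReal θ} {z : L}

/-- `z` centralizes `𝔨`, hence normalizes `𝔥`, and a Cartan subalgebra is its own normalizer. -/
theorem one_tmul_mem_of_le_kComplex (hz : IsComplexStructureElement J z)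
    (𝔥 : LieSubalgebra ℂ (ℂ ⊗[ℝ] L)) [𝔥.IsCartanSubalgebra]
    (h𝔥 : 𝔥.toSubmodule ≤ kComplex θ) : (1 : ℂ) ⊗ₜ[ℝ] z ∈ 𝔥 := by
  rw [← LieSubalgebra.IsCartanSubalgebra.self_normalizing (H := 𝔥),
    LieSubalgebra.mem_normalizer_iff']
  intro y hy
  rw [← lie_skew, show ⁅(1 : ℂ) ⊗ₜ[ℝ] z, y⁆ = 0 from lie_of_mem_kComplex hz (h𝔥 hy), neg_zero]
  exact 𝔥.zero_mem

/-- For `s` fixed by `θ`, `ad s` is skew for the definite form `-B(x, θ y)`, so its square has the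
same kernel. -/
theorem eq_zero_of_lie_lie_eq_zero (hθ : IsCartanInvolution θ) {s a : L} (hs : s ∈ kReal θ)
    (h : ⁅s, ⁅s, a⁆⁆ = 0) : ⁅s, a⁆ = 0 := by
  refine hθ.eq_zero_of_killingForm ?_
  have hs' : θ s = s := hs
  have h1 : killingForm ℝ L ⁅s, a⁆ (θ ⁅s, a⁆) = -killingForm ℝ L ⁅s, ⁅s, a⁆⁆ (θ a) := by
    rw [LieHom.map_lie, hs', eq_neg_iff_add_eq_zero]
    have := LieModule.traceForm_apply_lie_apply' ℝ L L s ⁅s, a⁆ (θ a)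
    rw [show killingForm ℝ L = LieModule.traceForm ℝ L L from rfl, this, add_neg_cancel]
  rw [h1, h, map_zero, LinearMap.zero_apply, neg_zero]

variable [FiniteDimensional ℝ L]

theorem adC_of_mem_rootSpace [LieAlgebra.IsKilling ℂ (ℂ ⊗[ℝ] L)]
    {𝔥 : LieSubalgebra ℂ (ℂ ⊗[ℝ] L)} [𝔥.IsCartanSubalgebra] (hz : (1 : ℂ) ⊗ₜ[ℝ] z ∈ 𝔥)
    {α : Module.Dual ℂ 𝔥} {e : ℂ ⊗[ℝ] L} (he : e ∈ LieAlgebra.rootSpace 𝔥 (α : 𝔥 → ℂ)) :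
    adC z e = α ⟨_, hz⟩ • e :=
  LieAlgebra.IsKilling.lie_eq_smul_of_mem_rootSpace he ⟨_, hz⟩

/-- For an adapted pair, positive root vectors are in `𝔭₊` or in `𝔨`. -/
theorem IsAdapted.mem_pPlus_or_mem_kComplex [LieAlgebra.IsKilling ℂ (ℂ ⊗[ℝ] L)]
    (hθ : IsCartanInvolution θ) (hJ : IsHermitianStructure θ J)
    (hz : IsComplexStructureElement J z) {𝔥 : LieSubalgebra ℂ (ℂ ⊗[ℝ] L)}
    [𝔥.IsCartanSubalgebra] {P : Set (Module.Dual ℂ 𝔥)} (hP : IsAdapted J 𝔥 P)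
    {α : Module.Dual ℂ 𝔥} (hα : α ∈ P) {e : ℂ ⊗[ℝ] L}
    (he : e ∈ LieAlgebra.rootSpace 𝔥 (α : 𝔥 → ℂ)) : e ∈ pPlus J ∨ e ∈ kComplex θ := by
  have hz𝔥 := one_tmul_mem_of_le_kComplex hz 𝔥 hP.le_kComplex
  by_cases he0 : e = 0
  · exact Or.inl (he0 ▸ zero_mem _)
  have h1 := adC_of_mem_rootSpace hz𝔥 he
  set c := α ⟨_, hz𝔥⟩ with hc
  have h2 := lie_lie_lie_eq_neg hθ hJ hz e
  simp only [h1, map_smul, smul_smul] at h2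
  rw [← neg_smul] at h2
  have h3 : c * (c * c + 1) = 0 := by linear_combination smul_left_injective ℂ he0 h2
  rcases mul_eq_zero.1 h3 with h0 | h0
  · exact Or.inr (mem_kComplex_of_lie hθ hJ hz (by rw [h1, h0, zero_smul]))
  have h4 : (c - Complex.I) * (c + Complex.I) = 0 := by
    linear_combination h0 - Complex.I_mul_I
  rcases mul_eq_zero.1 h4 with h5 | h5
  · exact Or.inl (mem_pPlus_of_lie hθ hJ hz (by rw [h1, sub_eq_zero.1 h5]))
  -- If `z` acts by `-i`, the root space of `-α` lies in `𝔭₊`, so `-α` would be positive together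
  -- with `α`.
  · refine absurd (hP.pPlus_subset (-α) (hP.isPositiveSystem.isRoot α hα).neg fun e' he' => ?_)
      (hP.isPositiveSystem.neg_notMem hα)
    refine mem_pPlus_of_lie hθ hJ hz ?_
    rw [adC_of_mem_rootSpace hz𝔥 he', LinearMap.neg_apply, ← hc, eq_neg_of_add_eq_zero_left h5,
      neg_neg]

/-- A Cartan subalgebra in `𝔨` is part of an adapted pair. -/
theorem exists_isAdapted_of_le_kComplex [LieAlgebra.IsKilling ℂ (ℂ ⊗[ℝ] L)]
    (hz : IsComplexStructureElement J z) (𝔥 : LieSubalgebra ℂ (ℂ ⊗[ℝ] L))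
    [𝔥.IsCartanSubalgebra] (h𝔥 : 𝔥.toSubmodule ≤ kComplex θ) :
    ∃ P : Set (Module.Dual ℂ 𝔥), IsAdapted J 𝔥 P := by
  have hz𝔥 := one_tmul_mem_of_le_kComplex hz 𝔥 h𝔥
  obtain ⟨H, hH⟩ : ∃ H : 𝔥, ∀ α : Module.Dual ℂ 𝔥, IsRoot 𝔥 α → α H ≠ 0 := by
    obtain ⟨H, hH⟩ := Module.Dual.exists_forall_ne_zero_of_forall_exists
      (fun w : 𝔥.root => (w : LieModule.Weight ℂ 𝔥 (ℂ ⊗[ℝ] L)).toLinear) (fun w => by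
        by_contra! hcon
        exact LieSubalgebra.isNonZero_coe_root w (funext fun x => hcon x))
    exact ⟨H, fun α hα => hH ⟨hα.toWeight, by simpa using hα.isNonZero⟩⟩
  let Z : 𝔥 := ⟨_, hz𝔥⟩
  -- Lexicographic order: `Im α(Z)` comes first, being `1` on the roots of `𝔭₊`; the regular element
  -- `H` breaks ties.
  let pos : Module.Dual ℂ 𝔥 → Prop := fun α => 0 < (α Z).im ∨ ((α Z).im = 0 ∧
    (0 < (α H).re ∨ ((α H).re = 0 ∧ 0 < (α H).im)))
  refine ⟨{α | IsRoot 𝔥 α ∧ pos α}, h𝔥, ⟨fun α hα => hα.1, fun α hα => ?_, ?_⟩, ?_⟩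
  · have hne : (α H).re ≠ 0 ∨ (α H).im ≠ 0 := by
      by_contra! hcon
      exact hH α hα (Complex.ext hcon.1 hcon.2)
    simp only [Set.mem_ofPred_eq, hα, hα.neg, true_and, pos, LinearMap.neg_apply, Complex.neg_im,
      Complex.neg_re, neg_eq_zero, Left.neg_pos_iff]
    rcases lt_trichotomy (α Z).im 0 with h1 | h1 | h1 <;>
      rcases lt_trichotomy (α H).re 0 with h2 | h2 | h2 <;>
      rcases lt_trichotomy (α H).im 0 with h3 | h3 | h3 <;>
      simp_all [not_lt_of_gt, ne_of_gt, ne_of_lt]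
  · rintro α ⟨-, hα⟩ β ⟨-, hβ⟩ hαβ
    refine ⟨hαβ, ?_⟩
    simp only [pos, LinearMap.add_apply, Complex.add_im, Complex.add_re] at hα hβ ⊢
    rcases hα with h1 | ⟨h1, h2 | ⟨h2, h3⟩⟩ <;> rcases hβ with h1' | ⟨h1', h2' | ⟨h2', h3'⟩⟩
    · left; linarith
    · left; linarith
    · left; linarith
    · left; linarith
    · right; exact ⟨by linarith, Or.inl (by linarith)⟩
    · right; exact ⟨by linarith, Or.inl (by linarith)⟩
    · left; linarith
    · right; exact ⟨by linarith, Or.inl (by linarith)⟩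
    · right; exact ⟨by linarith, Or.inr ⟨by linarith, by linarith⟩⟩
  · intro α hα hle
    refine ⟨hα, Or.inl ?_⟩
    obtain ⟨e, he, he0⟩ := (Submodule.ne_bot_iff _).1
      (fun h => hα.2 ((LieSubmodule.toSubmodule_eq_bot _).1 h))
    have h1 := adC_of_mem_rootSpace hz𝔥 he
    rw [lie_of_mem_pPlus hz (hle he)] at h1
    have h2 : Complex.I = α Z := smul_left_injective ℂ he0 h1
    simp [← h2]

/-- A maximal abelian subalgebra of `𝔨₀` is self-centralizing in `𝔤₀`. -/
theorem exists_selfCentralizing (hθ : IsCartanInvolution θ) (hJ : IsHermitianStructure θ J)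
    (hz : IsComplexStructureElement J z) :
    ∃ S : Submodule ℝ L, S ≤ (kReal θ).toSubmodule ∧ (∀ x ∈ S, ∀ y ∈ S, ⁅x, y⁆ = 0) ∧
      ∀ x, (∀ s ∈ S, ⁅s, x⁆ = 0) → x ∈ S := by
  let T : Set (Submodule ℝ L) :=
    {S | S ≤ (kReal θ).toSubmodule ∧ ∀ x ∈ S, ∀ y ∈ S, ⁅x, y⁆ = 0}
  obtain ⟨S, ⟨hSk, hSab⟩, hmax⟩ := (wellFounded_gt (α := Submodule ℝ L)).has_min T
    ⟨⊥, bot_le, by simp⟩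
  have hcent : ∀ x ∈ kReal θ, (∀ s ∈ S, ⁅s, x⁆ = 0) → x ∈ S := by
    intro x hx hxS
    have hmem : S ⊔ Submodule.span ℝ {x} ∈ T := by
      refine ⟨sup_le hSk (Submodule.span_le.2 (by simpa using hx)), ?_⟩
      intro u hu v hv
      obtain ⟨a, ha, b, hb, rfl⟩ := Submodule.mem_sup.1 hu
      obtain ⟨a', ha', b', hb', rfl⟩ := Submodule.mem_sup.1 hv
      obtain ⟨r, rfl⟩ := Submodule.mem_span_singleton.1 hb
      obtain ⟨r', rfl⟩ := Submodule.mem_span_singleton.1 hb'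
      have h1 : ⁅x, a'⁆ = 0 := by rw [← lie_skew, hxS a' ha', neg_zero]
      simp [hSab a ha a' ha', hxS a ha, h1]
    have hle : S ⊔ Submodule.span ℝ {x} ≤ S := by
      by_contra hcon
      exact hmax _ hmem (lt_of_le_not_ge le_sup_left hcon)
    exact hle (Submodule.mem_sup_right (Submodule.mem_span_singleton_self x))
  -- Maximality forces the central element `z` into `S`; anything centralizing `S` then commutes
  -- with `z` and so lies in `𝔨₀`.
  have hzS : z ∈ S := hcent z hz.mem_kReal fun s hs => by
    rw [← lie_skew, hz.lie_kReal s (hSk hs), neg_zero]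
  exact ⟨S, hSk, hSab, fun x hx => hcent x (hz.mem_kReal_of_lie_eq_zero hθ hJ (hx z hzS)) hx⟩

theorem exists_isCartanSubalgebra_le_kComplex (hθ : IsCartanInvolution θ)
    (hJ : IsHermitianStructure θ J) (hz : IsComplexStructureElement J z) :
    ∃ 𝔥 : LieSubalgebra ℂ (ℂ ⊗[ℝ] L), 𝔥.IsCartanSubalgebra ∧ 𝔥.toSubmodule ≤ kComplex θ := by
  obtain ⟨S, hSk, hSab, hScent⟩ := exists_selfCentralizing hθ hJ hz
  have hab : ∀ x ∈ S.baseChange ℂ, ∀ y ∈ S.baseChange ℂ,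
      LieAlgebra.ad ℂ (ℂ ⊗[ℝ] L) x y = 0 := by
    intro x hx y hy
    obtain ⟨a, b, rfl⟩ := exists_eq_one_tmul_add_I_tmul x
    obtain ⟨a', b', rfl⟩ := exists_eq_one_tmul_add_I_tmul y
    obtain ⟨ha, hb⟩ := mem_of_one_tmul_add_I_tmul_mem hx
    obtain ⟨ha', hb'⟩ := mem_of_one_tmul_add_I_tmul_mem hy
    simp [hSab _ ha _ ha', hSab _ ha _ hb', hSab _ hb _ ha', hSab _ hb _ hb']
  let 𝔥 : LieSubalgebra ℂ (ℂ ⊗[ℝ] L) :=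
    { S.baseChange ℂ with
      lie_mem' := fun {x y} hx hy => by
        have h1 : ⁅x, y⁆ = 0 := hab x hx y hy
        rw [h1]
        exact (S.baseChange ℂ).zero_mem }
  have habel : IsLieAbelian 𝔥 := ⟨fun x y => Subtype.ext (hab x x.2 y y.2)⟩
  refine ⟨𝔥, ⟨inferInstance, le_antisymm ?_ 𝔥.le_normalizer⟩, ?_⟩
  · intro w hw
    rw [LieSubalgebra.mem_normalizer_iff'] at hw
    obtain ⟨a, b, rfl⟩ := exists_eq_one_tmul_add_I_tmul w
    have h1 : ∀ s ∈ S, ⁅s, a⁆ ∈ S ∧ ⁅s, b⁆ ∈ S := by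
      intro s hs
      have h2 : (adC s) ((1 : ℂ) ⊗ₜ[ℝ] a + Complex.I ⊗ₜ[ℝ] b) ∈ S.baseChange ℂ :=
        hw ((1 : ℂ) ⊗ₜ[ℝ] s) (Submodule.tmul_mem_baseChange_of_mem 1 hs)
      rw [adC_eq_baseChange, map_add, LinearMap.baseChange_tmul, LinearMap.baseChange_tmul] at h2
      exact mem_of_one_tmul_add_I_tmul_mem h2
    -- If `x` normalizes the abelian `S`, then `(ad s)² x = 0`; skewness upgrades this to `[s, x] =
    -- 0`.
    have h3 : ∀ x, (∀ s ∈ S, ⁅s, x⁆ ∈ S) → x ∈ S := fun x hx => hScent x fun s hs =>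
      eq_zero_of_lie_lie_eq_zero hθ (hSk hs) (hSab s hs _ (hx s hs))
    exact add_mem (Submodule.tmul_mem_baseChange_of_mem 1 (h3 a fun s hs => (h1 s hs).1))
      (Submodule.tmul_mem_baseChange_of_mem Complex.I (h3 b fun s hs => (h1 s hs).2))
  · exact Submodule.baseChange_mono _ hSk

end AdaptedPairs

/-! ### The highest weight vector generates `X` -/

section Main

variable {E : Type*} [NormedAddCommGroup E] [NormedSpace ℝ E] [FiniteDimensional ℝ E]
  [CompleteSpace E] {G : Type*} [TopologicalSpace G] [T2Space G] [ChartedSpace E G] [Group G]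
  [LieGroup 𝓘(ℝ, E) ∞ G]
  {θ : GroupLieAlgebra 𝓘(ℝ, E) G →ₗ⁅ℝ⁆ GroupLieAlgebra 𝓘(ℝ, E) G}
  {J : pReal θ →ₗ[ℝ] pReal θ}
  {X : Type*} [AddCommGroup X] [Module ℂ X]
  [LieRingModule (gComplex E G) X] [LieModule ℂ (gComplex E G) X]
  {π : Representation ℂ (maxK θ) X}

instance instFiniteDimensionalGroupLieAlgebra :
    FiniteDimensional ℝ (GroupLieAlgebra 𝓘(ℝ, E) G) :=
  inferInstanceAs (FiniteDimensional ℝ E)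

/-- If `AV(X) ⊆ 𝔭₊`, then some nonzero vector of `X` is annihilated by `𝔭₊`. -/
theorem exists_pPlus_lie_eq_zero (hθ : IsCartanInvolution θ) (hJ : IsHermitianStructure θ J)
    {z : GroupLieAlgebra 𝓘(ℝ, E) G} (hz : IsComplexStructureElement J z) [Nontrivial X]
    (hπ : IsGKModule π) (X₀ : Submodule ℂ X) [FiniteDimensional ℂ X₀] (hstab : IsStable π X₀)
    (hgen : LieSubmodule.lieSpan ℂ (gComplex E G) (X₀ : Set X) = ⊤)
    (hAV : assocVariety (gComplex E G) X₀ ⊆ (pPlus J : Set (gComplex E G))) :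
    ∃ w : X, w ≠ 0 ∧ ∀ a ∈ pPlus J, ⁅a, w⁆ = 0 := by
  have := hθ.isKilling
  have : LieAlgebra.IsKilling ℂ (gComplex E G) := isKilling_complexification
  -- The factor `-i` turns the eigenvalues `i, 0, -i` of `ad z` into `1, 0, -1`.
  let h : gComplex E G := (-Complex.I) • ((1 : ℂ) ⊗ₜ[ℝ] z)
  have hh : ∀ x : gComplex E G,
      LieAlgebra.ad ℂ (gComplex E G) h x = (-Complex.I) • adC z x := by
    intro x
    rw [map_smul, LinearMap.smul_apply]
  refine exists_lie_eq_zero_of_assocVariety (h := h) (A := pPlus J) (B₀ := kComplex θ)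
    (B₁ := pMinus z) ?_ ?_ ?_ (pPlus_sup_kComplex_sup_pMinus hθ hJ hz) X₀ ?_ hgen
    fun y hy a ha => killingForm_pPlus hz (hAV hy) ha
  · intro a ha
    rw [← LieAlgebra.ad_apply ℂ, hh, lie_of_mem_pPlus hz ha, smul_smul, neg_mul, Complex.I_mul_I,
      neg_neg, one_smul]
  · intro a ha
    rw [← LieAlgebra.ad_apply ℂ, hh, lie_of_mem_kComplex hz ha, smul_zero]
  · intro a ha
    rw [← LieAlgebra.ad_apply ℂ, hh, lie_of_mem_pMinus ha, smul_smul, neg_mul_neg, Complex.I_mul_I,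
      neg_one_smul]
  · intro v hv
    rw [show ⁅h, v⁆ = (-Complex.I) • ⁅(1 : ℂ) ⊗ₜ[ℝ] z, v⁆ from smul_lie _ _ _]
    exact X₀.smul_mem _ (hπ.tmul_lie_mem hstab hz.mem_kReal hv)

theorem isHighestWeightModule_of_assocVariety_subset (hθ : IsCartanInvolution θ)
    (hJ : IsHermitianStructure θ J) {z : GroupLieAlgebra 𝓘(ℝ, E) G}
    (hz : IsComplexStructureElement J z) (hX : IsIrreducibleHC π)
    (X₀ : Submodule ℂ X) [FiniteDimensional ℂ X₀] (hstab : IsStable π X₀)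
    (hgen : LieSubmodule.lieSpan ℂ (gComplex E G) (X₀ : Set X) = ⊤)
    (hAV : assocVariety (gComplex E G) X₀ ⊆ (pPlus J : Set (gComplex E G)))
    (𝔥 : LieSubalgebra ℂ (gComplex E G)) [𝔥.IsCartanSubalgebra] (P : Set (Module.Dual ℂ 𝔥))
    (hP : IsAdapted J 𝔥 P) : IsHighestWeightModule X 𝔥 P := by
  have := hX.nontrivial
  have := hθ.isKilling
  have : LieAlgebra.IsKilling ℂ (gComplex E G) := isKilling_complexification
  have hπ := hX.isGKModule
  obtain ⟨w, hw0, hw⟩ := exists_pPlus_lie_eq_zero hθ hJ hz hπ X₀ hstab hgen hAV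
  obtain ⟨V, hVfin, hV, hwV⟩ := hπ.locallyFinite w
  let N : Submodule ℂ X :=
    { carrier := {v | ∀ a ∈ pPlus J, ⁅a, v⁆ = 0}
      add_mem' := fun {u v} hu hv a ha => by rw [lie_add, hu a ha, hv a ha, add_zero]
      zero_mem' := fun a _ => lie_zero a
      smul_mem' := fun c v hv a ha => by rw [lie_smul, hv a ha, smul_zero] }
  -- `N`, the space of vectors killed by `𝔭₊`, is `𝔨`-stable because `[𝔨, 𝔭₊] ⊆ 𝔭₊`.
  have hk : ∀ x ∈ kComplex θ, ∀ v ∈ V ⊓ N, ⁅x, v⁆ ∈ V ⊓ N := by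
    rintro x hx v ⟨hvV, hvN⟩
    refine ⟨hπ.lie_mem hV hx hvV, fun a ha => ?_⟩
    have h1 := leibniz_lie x a v
    have h2 : ⁅⁅x, a⁆, v⁆ = 0 := hvN _ (lie_mem_pPlus hθ hJ hz hx ha)
    rw [hvN a ha, lie_zero, h2, zero_add] at h1
    exact h1.symm
  have hfin : FiniteDimensional ℂ (V ⊓ N : Submodule ℂ X) :=
    Submodule.finiteDimensional_of_le inf_le_left
  obtain ⟨v, hvW, lam, hv0, hvlam, hvP⟩ := hP.isPositiveSystem.exists_highestWeightVector (V ⊓ N)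
    ((Submodule.ne_bot_iff _).2 ⟨w, ⟨hwV, hw⟩, hw0⟩)
    (fun H u hu => hk H (hP.le_kComplex H.2) u hu) (fun α hα e he u hu => by
      rcases hP.mem_pPlus_or_mem_kComplex hθ hJ hz hα he with h1 | h1
      · rw [hu.2 e h1]
        exact zero_mem _
      · exact hk e h1 u hu)
  refine ⟨v, lam, hv0, hvlam, hvP, ?_⟩
  refine (hX.irreducible _ (hπ.isStable_lieSubmodule _)).resolve_left fun hbot => hv0 ?_
  have hmem : v ∈ LieSubmodule.lieSpan ℂ (gComplex E G) {v} :=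
    LieSubmodule.subset_lieSpan rfl
  rwa [hbot, LieSubmodule.mem_bot] at hmem

end Main

end HermitianHC

open HermitianHC in
theorem mainTheorem10
    {E : Type*} [NormedAddCommGroup E] [NormedSpace ℝ E] [FiniteDimensional ℝ E] [CompleteSpace E]
    {G : Type*} [TopologicalSpace G] [T2Space G] [ConnectedSpace G] [ChartedSpace E G] [Group G]
    [LieGroup 𝓘(ℝ, E) ∞ G]
    [LieAlgebra.IsSemisimple ℝ (GroupLieAlgebra 𝓘(ℝ, E) G)]
    (θ : GroupLieAlgebra 𝓘(ℝ, E) G →ₗ⁅ℝ⁆ GroupLieAlgebra 𝓘(ℝ, E) G) (hθ : IsCartanInvolution θ)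
    (J : pReal θ →ₗ[ℝ] pReal θ) (hJ : IsHermitianStructure θ J)
    {X : Type*} [AddCommGroup X] [Module ℂ X]
    [LieRingModule (gComplex E G) X] [LieModule ℂ (gComplex E G) X]
    (π : Representation ℂ (maxK θ) X) (hX : IsIrreducibleHC π)
    (X₀ : Submodule ℂ X) (hfin : FiniteDimensional ℂ X₀) (hstab : IsStable π X₀)
    (hgen : LieSubmodule.lieSpan ℂ (gComplex E G) (X₀ : Set X) = ⊤)
    (hAV : assocVariety (gComplex E G) X₀ ⊆ (pPlus J : Set (gComplex E G))) :
    (∃ (𝔥 : LieSubalgebra ℂ (gComplex E G)) (_ : 𝔥.IsCartanSubalgebra)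
        (P : Set (Module.Dual ℂ 𝔥)), IsAdapted J 𝔥 P) ∧
    ∀ (𝔥 : LieSubalgebra ℂ (gComplex E G)) [𝔥.IsCartanSubalgebra] (P : Set (Module.Dual ℂ 𝔥)),
      IsAdapted J 𝔥 P → IsHighestWeightModule X 𝔥 P := by
  obtain ⟨z, hz⟩ := exists_isComplexStructureElement hθ hJ
  have := hθ.isKilling
  have : LieAlgebra.IsKilling ℂ (gComplex E G) := isKilling_complexification
  refine ⟨?_, fun 𝔥 _ P hP => isHighestWeightModule_of_assocVariety_subset hθ hJ hz hX X₀ hstab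
    hgen hAV 𝔥 P hP⟩
  obtain ⟨𝔥, h𝔥, hle⟩ := exists_isCartanSubalgebra_le_kComplex hθ hJ hz
  obtain ⟨P, hP⟩ := exists_isAdapted_of_le_kComplex hz 𝔥 hle
  exact ⟨𝔥, h𝔥, P, hP⟩
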